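/- Let $n\ge 1$, let $\mathbb B$ be the open unit ball of $\mathbb C^n$, and let $dV$ be Lebesgue measure on $\mathbb B$ normalized by $V(\mathbb B)=1$. A radial weight is a positive, measurable, integrable function $\omega$ on $[0,1)$, extended to $\mathbb B$ by $\omega(z)=\omega(|z|)$; write $\hat\omega(r)=\int_r^1\omega(t)\,dt$ and $\omega(E)=\int_E\omega\,dV$ for measurable $E\subset\mathbb B$. Write $\omega\in\mathcal D$ if $\omega$ is a radial weight such that (a) there is $C>0$ with $\hat\omega(r)<C\,\hat\omega\left(\frac{1+r}{2}\right)$ for all $0\le r<1$, and (b) there are $K>1$ and $C>1$ with $\hat\omega(r)\ge C\,\hat\omega\left(1-\frac{1-r}{K}\right)$ for all $r\in(0,1)$. For $\omega\in\mathcal D$ let $K_\omega$ be the infimum of all $K>1$ for which (b) holds with some $C>1$. A radial weight $\omega$ is regular if there are $C>0$ and $\delta\in(0,1)$ with $\frac1C<\frac{\hat\omega(r)}{(1-r)\omega(r)}<C$ for all $r\in(\delta,1)$. For $z\in\mathbb B$ let $P_z$ be the orthogonal projection of $\mathbb C^n$ onto the span of $z$ (so $P_0=0$) and $P_z^\perp=I-P_z$.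 For $z,w\in\mathbb B$ and $0<r<1$ put $$\rho(z,w)=\left|\frac{z-P_z(w)-\sqrt{1-|z|^2}\,P_z^\perp(w)}{1-\langle w,z\rangle}\right|,\qquad \Delta(z,r)=\{w\in\mathbb B:\rho(z,w)<r\}.$$ For $a\in\mathbb B\setminus\{0\}$ let $$S_a=\left\{z\in\mathbb B:\ |a|<|z|<1,\ \left|1-\left\langle \tfrac{a}{|a|},\tfrac{z}{|z|}\right\rangle\right|^{1/2}\le\sqrt{1-|a|}\right\},$$ and let $S_0=\mathbb B$. (1) Let $0<r<1$ and $\omega\in\mathcal D$ with $\frac1{K_\omega}+\frac{2r}{1+r^2}>1$. Then $$\omega(\Delta(z,r))\approx\omega(\Delta(w,r))\approx\omega(S_z)\approx\omega(S_w)\qquad\text{for all } z\in\mathbb B,\ w\in\Delta(z,r),$$ where $A\approx B$ means $A\le CB$ and $B\le CA$ with a constant $C>0$ that may depend on $n$, $\omega$ and $r$ but not on $z$ and $w$. (2) If $\omega$ is regular, then the same comparability holds for every fixed $r\in(0,1)$, with $C$ depending only on $n$, $\omega$ and $r$. -/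

import Mathlib

open MeasureTheory Set

noncomputable section

namespace BallWeights

/-- `ω` is (the radial profile of) a radial weight: positive on `[0, 1)` and Lebesgue integrable
there (`IntegrableOn` contains measurability).  The weight on the ball is `z ↦ ω ‖z‖`. -/
structure IsRadialWeight (ω : ℝ → ℝ) : Prop where
  pos : ∀ t ∈ Ico (0 : ℝ) 1, 0 < ω t
  integrable : IntegrableOn ω (Ico (0 : ℝ) 1) volume

/-- The tail integral `∫_r^1 ω(t) dt`. -/
def tail (ω : ℝ → ℝ) (r : ℝ) : ℝ := ∫ t in r..1, ω t

/-- Doubling weights. -/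
def IsDoubling (ω : ℝ → ℝ) : Prop :=
  IsRadialWeight ω ∧
    ∃ C : ℝ, 0 < C ∧ ∀ r ∈ Ico (0 : ℝ) 1, tail ω r < C * tail ω ((1 + r) / 2)

/-- The constants `K > 1` for which the reverse doubling inequality holds with some `C > 1`. -/
def reverseDoublingConstants (ω : ℝ → ℝ) : Set ℝ :=
  {K | 1 < K ∧ ∃ C : ℝ, 1 < C ∧
    ∀ r ∈ Ioo (0 : ℝ) 1, C * tail ω (1 - (1 - r) / K) ≤ tail ω r}

/-- Reverse doubling weights. -/
def IsReverseDoubling (ω : ℝ → ℝ) : Prop :=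
  IsRadialWeight ω ∧ (reverseDoublingConstants ω).Nonempty

/-- The class of weights that are both doubling and reverse doubling. -/
def IsTwoSidedDoubling (ω : ℝ → ℝ) : Prop :=
  IsDoubling ω ∧ IsReverseDoubling ω

/-- The infimum `K_ω` of the admissible reverse doubling constants. -/
def infReverseDoubling (ω : ℝ → ℝ) : ℝ := sInf (reverseDoublingConstants ω)

/-- Regular weights (no continuity is required). -/
def IsRegularWeight (ω : ℝ → ℝ) : Prop :=
  IsRadialWeight ω ∧
    ∃ C : ℝ, 0 < C ∧ ∃ δ ∈ Ioo (0 : ℝ) 1, ∀ r ∈ Ioo δ 1,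
      1 / C < tail ω r / ((1 - r) * ω r) ∧ tail ω r / ((1 - r) * ω r) < C

/-- `ℂⁿ` with its Hermitian norm. -/
abbrev Cn (n : ℕ) : Type := EuclideanSpace ℂ (Fin n)

/-- The open unit ball of `ℂⁿ`. -/
def unitBall (n : ℕ) : Set (Cn n) := Metric.ball 0 1

/-- Lebesgue measure on the unit ball, normalized to total mass one. -/
def ballMeasure (n : ℕ) : Measure (Cn n) :=
  (volume (unitBall n))⁻¹ • volume.restrict (unitBall n)

/-- The weighted measure `ω(E) = ∫_E ω(|z|) dV(z)`. -/
def weightedMass {n : ℕ} (ω : ℝ → ℝ) (E : Set (Cn n)) : ℝ :=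
  ∫ z in E, ω ‖z‖ ∂(ballMeasure n)

/-- The pseudo-hyperbolic distance.  Mathlib's inner product is conjugate linear in its first
argument, so `⟨w, z⟩ = ∑ w_k conj(z_k)` is `inner ℂ z w`; `P_z` is the orthogonal projection onto
the span of `z`. -/
def pseudoDist {n : ℕ} (z w : Cn n) : ℝ :=
  ‖(1 - inner ℂ z w)⁻¹ •
    (z - (ℂ ∙ z).starProjection w
      - (Real.sqrt (1 - ‖z‖ ^ 2) : ℂ) • (w - (ℂ ∙ z).starProjection w))‖

/-- The pseudo-hyperbolic ball `Δ(z, r)`. -/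
def pseudoBall {n : ℕ} (z : Cn n) (r : ℝ) : Set (Cn n) :=
  {w | w ∈ unitBall n ∧ pseudoDist z w < r}

/-- The nonisotropic distance `|1 - ⟨ξ, τ⟩|^{1/2}`. -/
def nonisoDist {n : ℕ} (ξ τ : Cn n) : ℝ := Real.sqrt ‖1 - inner ℂ τ ξ‖

/-- The nonisotropic ball `Q(ξ, r)` in the unit sphere. -/
def nonisoBall {n : ℕ} (ξ : Cn n) (r : ℝ) : Set (Cn n) :=
  {η | η ∈ Metric.sphere (0 : Cn n) 1 ∧ nonisoDist ξ η ≤ r}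

/-- The unit vector `z / |z|` (used for `z ≠ 0`). -/
def direction {n : ℕ} (z : Cn n) : Cn n := ((‖z‖ : ℂ)⁻¹) • z

open Classical in
/-- The Carleson block `S_a`; it is the whole ball when `a = 0`. -/
def carlesonBlock {n : ℕ} (a : Cn n) : Set (Cn n) :=
  if a = 0 then unitBall n
  else {z | z ∈ unitBall n ∧ ‖a‖ < ‖z‖ ∧
    direction z ∈ nonisoBall (direction a) (Real.sqrt (1 - ‖a‖))}

/-- `A` and `B` are comparable with constant `C`. -/
def ComparableWith (C A B : ℝ) : Prop := A ≤ C * B ∧ B ≤ C * A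

/-- `ω(Δ(z,r)) ≈ ω(Δ(w,r)) ≈ ω(S_z) ≈ ω(S_w)`, uniformly in `z` in the ball and `w ∈ Δ(z,r)`. -/
def BlocksComparable (n : ℕ) (ω : ℝ → ℝ) (r : ℝ) : Prop :=
  ∃ C : ℝ, 0 < C ∧ ∀ z ∈ unitBall n, ∀ w ∈ pseudoBall z r,
    ComparableWith C (weightedMass ω (pseudoBall z r)) (weightedMass ω (pseudoBall w r)) ∧
    ComparableWith C (weightedMass ω (pseudoBall w r)) (weightedMass ω (carlesonBlock z)) ∧
    ComparableWith C (weightedMass ω (carlesonBlock z)) (weightedMass ω (carlesonBlock w))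

end BallWeights

end

noncomputable section

namespace BallWeights

/-! ### The nonisotropic quasi-metric on the unit sphere -/

section InnerProduct

variable {E : Type*} [NormedAddCommGroup E] [InnerProductSpace ℂ E]

/-! Everything is measured against one quantity, `blockSize`: with x = 1 - |z| it is, up to a
dimensional constant, the surface measure of the cap of size x around z/|z| times the tail at |z|. A
Carleson block with nonzero vertex is exactly a polar sector over such a cap, so its mass is
comparable to `blockSize`; doubling of the tail takes care of the Jacobian near the origin.

The identity 1 - ρ(z,w)² = (1-|z|²)(1-|w|²)/|1-⟨w,z⟩|² puts Δ(z,r), for z near the boundary, inside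
a sector of height and width O(x), and doubling of tails and caps gives the upper bound for its
mass. Conversely, if k(1-r) < 1+r, c is small and z is near the boundary, then Δ(z,r) contains the
sector of width cx over the radii (1-kx, 1-x/k). With k² = K, reverse doubling says that these radii
carry a fixed proportion of the tail at 1-kx, hence at least a multiple of the tail at |z|. So an
admissible K < ((1+r)/(1-r))² is what the lower bound needs, and the hypothesis on K_ω provides it.

Caps double because the homothety with centre ζ and ratio s multiplies 1-⟨z,ζ⟩ by s and volume by a
power of s. Away from the boundary all masses lie between a positive constant and the mass of the
ball. Points of Δ(z,r) have comparable distances to the sphere and nearby directions, which compares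
S_z with S_w. A regular weight is doubling with K_ω = 1, so (2) is a case of (1). -/

theorem norm_one_sub_inner_comm (x y : E) : ‖1 - inner ℂ x y‖ = ‖1 - inner ℂ y x‖ := by
  rw [← inner_conj_symm x y, ← Complex.norm_conj]
  simp

theorem norm_one_sub_inner_sq (x y : E) :
    ‖1 - inner ℂ x y‖ ^ 2 = 1 - 2 * (inner ℂ x y).re + ‖inner ℂ x y‖ ^ 2 := by
  rw [← Complex.normSq_eq_norm_sq, ← Complex.normSq_eq_norm_sq, Complex.normSq_apply,
    Complex.normSq_apply]
  simp
  ring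

theorem one_sub_norm_mul_norm_le (x y : E) : 1 - ‖x‖ * ‖y‖ ≤ ‖1 - inner ℂ x y‖ := by
  have h1 := norm_inner_le_norm (𝕜 := ℂ) x y
  have h2 := norm_sub_norm_le (1 : ℂ) (inner ℂ x y)
  rw [norm_one] at h2
  linarith

theorem one_sub_norm_inner_sq_le {x y : E} (hx : ‖x‖ = 1) (hy : ‖y‖ = 1) :
    1 - ‖inner ℂ x y‖ ^ 2 ≤ 2 * ‖1 - inner ℂ x y‖ := by
  have h1 := norm_inner_le_norm (𝕜 := ℂ) x y
  have h2 := norm_sub_norm_le (1 : ℂ) (inner ℂ x y)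
  rw [norm_one] at h2
  rw [hx, hy] at h1
  nlinarith [norm_nonneg (inner ℂ x y), norm_nonneg (1 - inner ℂ x y)]

theorem norm_sub_inner_smul_sq {x y : E} (hy : ‖y‖ = 1) :
    ‖x - inner ℂ y x • y‖ ^ 2 = ‖x‖ ^ 2 - ‖inner ℂ y x‖ ^ 2 := by
  have h : inner ℂ (inner ℂ y x • y) (x - inner ℂ y x • y) = (0 : ℂ) := by
    rw [inner_smul_left, inner_sub_right, inner_smul_right, inner_self_eq_norm_sq_to_K, hy]
    simp
  have h2 := norm_add_sq_eq_norm_sq_add_norm_sq_of_inner_eq_zero _ _ h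
  rw [add_sub_cancel, norm_smul, hy] at h2
  nlinarith

/-- The nonisotropic quasi-triangle inequality on the unit sphere. -/
theorem norm_one_sub_inner_le {x y z : E} (hx : ‖x‖ = 1) (hy : ‖y‖ = 1) (hz : ‖z‖ = 1) :
    ‖1 - inner ℂ x z‖ ≤ 2 * (‖1 - inner ℂ x y‖ + ‖1 - inner ℂ y z‖) := by
  set a := inner ℂ y x with ha
  set b := inner ℂ y z with hb
  have hxa : inner ℂ x y = star a := (inner_conj_symm x y).symm
  -- After removal of the components along y, what remains of ⟨x,z⟩ pairs two vectors orthogonal to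
  -- y. Their squared norms 1-|a|² and 1-|b|² are at most twice the distances to y, so
  -- Cauchy-Schwarz and AM-GM finish the proof.
  have key : inner ℂ x z - star a * b = inner ℂ (x - a • y) (z - b • y) := by
    simp only [inner_sub_left, inner_sub_right, inner_smul_left, inner_smul_right,
      inner_self_eq_norm_sq_to_K, hy, ← hb, hxa]
    simp
  have h1 : ‖inner ℂ x z - star a * b‖ ≤ ‖x - a • y‖ * ‖z - b • y‖ :=
    key ▸ norm_inner_le_norm _ _
  have h2 : ‖x - a • y‖ ^ 2 ≤ 2 * ‖1 - inner ℂ x y‖ := by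
    rw [norm_sub_inner_smul_sq hy, hx, norm_one_sub_inner_comm, one_pow]
    exact one_sub_norm_inner_sq_le hy hx
  have h3 : ‖z - b • y‖ ^ 2 ≤ 2 * ‖1 - inner ℂ y z‖ := by
    rw [norm_sub_inner_smul_sq hy, hz, one_pow]
    exact one_sub_norm_inner_sq_le hy hz
  have h4 : ‖1 - star a * b‖ ≤ ‖1 - inner ℂ x y‖ + ‖1 - inner ℂ y z‖ := by
    have : 1 - star a * b = (1 - star a) + star a * (1 - b) := by ring
    have ha1 : ‖star a‖ ≤ 1 := by
      simpa [hx, hy] using norm_inner_le_norm (𝕜 := ℂ) y x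
    rw [this, hxa, ← hb]
    refine (norm_add_le _ _).trans (add_le_add le_rfl ?_)
    rw [norm_mul]
    exact mul_le_of_le_one_left (norm_nonneg _) ha1
  have h5 : ‖1 - inner ℂ x z‖ ≤ ‖1 - star a * b‖ + ‖inner ℂ x z - star a * b‖ := by
    have : 1 - inner ℂ x z = (1 - star a * b) - (inner ℂ x z - star a * b) := by ring
    rw [this]
    exact norm_sub_le _ _
  nlinarith [sq_nonneg (‖x - a • y‖ - ‖z - b • y‖)]

end InnerProduct

/-! ### Pseudo-hyperbolic balls: radii and directions -/

section Geometry

variable {n : ℕ}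

theorem mem_unitBall {z : Cn n} : z ∈ unitBall n ↔ ‖z‖ < 1 := by
  simp [unitBall]

theorem norm_direction {z : Cn n} (hz : z ≠ 0) : ‖direction z‖ = 1 := by
  simp [direction, norm_smul, hz]

theorem norm_smul_direction {z : Cn n} (hz : z ≠ 0) : (‖z‖ : ℂ) • direction z = z := by
  rw [direction, smul_inv_smul₀]
  simpa using hz

theorem direction_eq_real_smul (z : Cn n) : direction z = ‖z‖⁻¹ • z := by
  rw [direction, ← Complex.ofReal_inv]
  rfl

theorem inner_eq_mul_inner_direction {z w : Cn n} (hz : z ≠ 0) (hw : w ≠ 0) :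
    inner ℂ z w = (‖z‖ * ‖w‖ : ℝ) * inner ℂ (direction z) (direction w) := by
  conv_lhs => rw [← norm_smul_direction hz, ← norm_smul_direction hw]
  rw [inner_smul_left, inner_smul_right]
  simp
  ring

/-- `1 - ρ(z, w)²` in terms of inner products, cleared of its denominator. -/
theorem norm_pseudoDist_numerator_sq (z w : Cn n) (hz : ‖z‖ ≤ 1) :
    ‖z - (ℂ ∙ z).starProjection w
      - (Real.sqrt (1 - ‖z‖ ^ 2) : ℂ) • (w - (ℂ ∙ z).starProjection w)‖ ^ 2
      = ‖1 - inner ℂ z w‖ ^ 2 - (1 - ‖z‖ ^ 2) * (1 - ‖w‖ ^ 2) := by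
  set p := (ℂ ∙ z).starProjection w with hp
  have hpm : p ∈ (ℂ ∙ z) := Submodule.starProjection_apply_mem _ w
  have hzm : z ∈ (ℂ ∙ z) := Submodule.mem_span_singleton_self z
  have hq : w - p ∈ (ℂ ∙ z)ᗮ := Submodule.sub_starProjection_mem_orthogonal w
  have hzq : inner ℂ z (w - p) = (0 : ℂ) := hq z hzm
  have hpq : inner ℂ p (w - p) = (0 : ℂ) := hq p hpm
  have hzp : inner ℂ z p = inner ℂ z w := by
    rw [inner_sub_right] at hzq
    exact (sub_eq_zero.mp hzq).symm
  have hpn : ‖p‖ ^ 2 * ‖z‖ ^ 2 = ‖inner ℂ z w‖ ^ 2 := by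
    obtain ⟨c, hc⟩ := Submodule.mem_span_singleton.mp hpm
    rw [← hzp, ← hc, inner_smul_right, inner_self_eq_norm_sq_to_K, norm_smul, norm_mul]
    simp
    ring
  have hw : ‖w‖ ^ 2 = ‖p‖ ^ 2 + ‖w - p‖ ^ 2 := by
    have := norm_add_sq_eq_norm_sq_add_norm_sq_of_inner_eq_zero _ _ hpq
    rw [add_sub_cancel] at this
    nlinarith
  have hs : Real.sqrt (1 - ‖z‖ ^ 2) ^ 2 = 1 - ‖z‖ ^ 2 :=
    Real.sq_sqrt (by nlinarith [norm_nonneg z])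
  -- Pythagoras: z - p lies on the line of z and w - p is orthogonal to it.
  have hperp : inner ℂ (z - p) (-((Real.sqrt (1 - ‖z‖ ^ 2) : ℂ) • (w - p))) = (0 : ℂ) := by
    rw [inner_neg_right, inner_smul_right, inner_sub_left, hzq, hpq]
    simp
  have h1 := norm_add_sq_eq_norm_sq_add_norm_sq_of_inner_eq_zero _ _ hperp
  rw [← sub_eq_add_neg, norm_neg, norm_smul, Complex.norm_real, Real.norm_eq_abs,
    abs_of_nonneg (Real.sqrt_nonneg _)] at h1
  have h2 : ‖z - p‖ ^ 2 = ‖z‖ ^ 2 - 2 * (inner ℂ z w).re + ‖p‖ ^ 2 := by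
    rw [← hzp]
    exact norm_sub_sq (𝕜 := ℂ) z p
  have h3 : ‖z - p - (Real.sqrt (1 - ‖z‖ ^ 2) : ℂ) • (w - p)‖ ^ 2
      = ‖z - p‖ ^ 2 + Real.sqrt (1 - ‖z‖ ^ 2) ^ 2 * ‖w - p‖ ^ 2 := by
    rw [sq, h1]
    ring
  rw [h3, h2, hs, norm_one_sub_inner_sq, ← hpn]
  have : ‖w - p‖ ^ 2 = ‖w‖ ^ 2 - ‖p‖ ^ 2 := by linarith
  rw [this]
  ring

theorem norm_one_sub_inner_pos {z w : Cn n} (hz : ‖z‖ < 1) (hw : ‖w‖ < 1) :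
    0 < ‖1 - inner ℂ z w‖ := by
  have := one_sub_norm_mul_norm_le z w
  nlinarith [norm_nonneg z, norm_nonneg w]

theorem pseudoDist_eq_div (z w : Cn n) :
    pseudoDist z w = ‖z - (ℂ ∙ z).starProjection w
      - (Real.sqrt (1 - ‖z‖ ^ 2) : ℂ) • (w - (ℂ ∙ z).starProjection w)‖
        / ‖1 - inner ℂ z w‖ := by
  rw [pseudoDist, norm_smul, norm_inv, div_eq_inv_mul]

theorem pseudoDist_lt_iff {z w : Cn n} (hz : ‖z‖ < 1) (hw : ‖w‖ < 1) {r : ℝ} (hr : 0 < r) :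
    pseudoDist z w < r ↔
      ‖1 - inner ℂ z w‖ ^ 2 * (1 - r ^ 2) < (1 - ‖z‖ ^ 2) * (1 - ‖w‖ ^ 2) := by
  have hpos := norm_one_sub_inner_pos hz hw
  rw [pseudoDist_eq_div, div_lt_iff₀ hpos, ← abs_of_nonneg (norm_nonneg (z - _ - _)),
    ← abs_of_pos (mul_pos hr hpos), ← sq_lt_sq, norm_pseudoDist_numerator_sq z w hz.le, mul_pow]
  constructor <;> intro h <;> linarith

/-- The squared numerator equals |z-w|² - (|z|²|w|² - |⟨z,w⟩|²), at most |z-w|² by Cauchy-Schwarz,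
and the denominator is at least 1-|z||w|. This puts Euclidean balls inside Δ(z,r) when z stays in a
compact set. -/
theorem pseudoDist_le_div {z w : Cn n} (hz : ‖z‖ < 1) (hw : ‖w‖ < 1) :
    pseudoDist z w ≤ ‖z - w‖ / (1 - ‖z‖) := by
  have hpos := norm_one_sub_inner_pos hz hw
  have h1 := one_sub_norm_mul_norm_le z w
  have h2 : ‖1 - inner ℂ z w‖ ^ 2 - (1 - ‖z‖ ^ 2) * (1 - ‖w‖ ^ 2) ≤ ‖z - w‖ ^ 2 := by
    rw [norm_one_sub_inner_sq, norm_sub_sq (𝕜 := ℂ) z w]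
    have := norm_inner_le_norm (𝕜 := ℂ) z w
    have := pow_le_pow_left₀ (norm_nonneg _) this 2
    simp only [RCLike.re_to_complex]
    nlinarith
  rw [← norm_pseudoDist_numerator_sq z w hz.le] at h2
  have h3 := abs_le_abs_of_nonneg (norm_nonneg _) ((pow_le_pow_iff_left₀ (norm_nonneg _)
    (norm_nonneg _) two_ne_zero).mp h2)
  simp only [abs_norm] at h3
  rw [pseudoDist_eq_div]
  refine div_le_div₀ (norm_nonneg _) h3 (by linarith) (le_trans ?_ h1)
  nlinarith [norm_nonneg z]

/-- Points of a pseudo-hyperbolic ball are at comparable distance from the boundary, and lie in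
comparable directions. -/
theorem le_of_mem_pseudoBall {z w : Cn n} {r : ℝ} (hr : r ∈ Ioo (0 : ℝ) 1) (hz : z ∈ unitBall n)
    (hw : w ∈ pseudoBall z r) :
    1 - ‖w‖ ≤ 4 / (1 - r ^ 2) * (1 - ‖z‖) ∧ 1 - ‖z‖ ≤ 4 / (1 - r ^ 2) * (1 - ‖w‖) ∧
      ‖1 - inner ℂ z w‖ ≤ 4 / (1 - r ^ 2) * (1 - ‖z‖) := by
  obtain ⟨hw1, hwr⟩ := hw
  rw [mem_unitBall] at hz hw1
  rw [pseudoDist_lt_iff hz hw1 hr.1] at hwr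
  have hr2 : 0 < 1 - r ^ 2 := by nlinarith [hr.1, hr.2]
  have h1 := one_sub_norm_mul_norm_le z w
  have hz0 := norm_nonneg z
  have hw0 := norm_nonneg w
  have hx : 1 - ‖z‖ ≤ ‖1 - inner ℂ z w‖ := by nlinarith
  have hy : 1 - ‖w‖ ≤ ‖1 - inner ℂ z w‖ := by nlinarith
  set x := 1 - ‖z‖ with hxdef
  set y := 1 - ‖w‖ with hydef
  set q := ‖1 - inner ℂ z w‖
  have hx0 : 0 < x := by linarith
  have hy0 : 0 < y := by linarith
  have hB : (1 - ‖z‖ ^ 2) * (1 - ‖w‖ ^ 2) ≤ 4 * x * y := by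
    have e1 : 1 - ‖z‖ ^ 2 ≤ 2 * x := by nlinarith
    have e2 : 1 - ‖w‖ ^ 2 ≤ 2 * y := by nlinarith
    have e3 : 0 ≤ 1 - ‖w‖ ^ 2 := by nlinarith
    nlinarith
  -- Since x, y ≤ q, one factor cancels: y from y²(1-r²) ≤ 4xy, x from x²(1-r²) ≤ 4xy, and q from
  -- q²(1-r²) ≤ 4xq.
  have hq : q ^ 2 * (1 - r ^ 2) < 4 * x * y := lt_of_lt_of_le hwr hB
  have hx2 : x ^ 2 * (1 - r ^ 2) ≤ q ^ 2 * (1 - r ^ 2) := by gcongr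
  have hy2 : y ^ 2 * (1 - r ^ 2) ≤ q ^ 2 * (1 - r ^ 2) := by gcongr
  have hyx : y * (1 - r ^ 2) ≤ 4 * x := by
    have : y * (y * (1 - r ^ 2)) ≤ y * (4 * x) := by nlinarith
    exact le_of_mul_le_mul_left this hy0
  have hxy : x * (1 - r ^ 2) ≤ 4 * y := by
    have : x * (x * (1 - r ^ 2)) ≤ x * (4 * y) := by nlinarith
    exact le_of_mul_le_mul_left this hx0
  refine ⟨?_, ?_, ?_⟩
  · rw [div_mul_eq_mul_div, le_div_iff₀ hr2]; exact hyx
  · rw [div_mul_eq_mul_div, le_div_iff₀ hr2]; exact hxy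
  · rw [div_mul_eq_mul_div, le_div_iff₀ hr2]
    have hq0 : 0 < q := lt_of_lt_of_le hx0 hx
    have : q * (q * (1 - r ^ 2)) ≤ q * (4 * x) := by nlinarith
    exact le_of_mul_le_mul_left this hq0

theorem norm_one_sub_inner_direction_le {z w : Cn n} (hz0 : z ≠ 0) (hw0 : w ≠ 0) :
    ‖1 - inner ℂ (direction z) (direction w)‖ ≤ ‖1 - inner ℂ z w‖ + |1 - ‖z‖ * ‖w‖| := by
  set u := inner ℂ (direction z) (direction w) with hu
  have hu1 : ‖u‖ ≤ 1 := by
    simpa [norm_direction hz0, norm_direction hw0] using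
      norm_inner_le_norm (𝕜 := ℂ) (direction z) (direction w)
  rw [inner_eq_mul_inner_direction hz0 hw0, ← hu]
  have : 1 - u = (1 - (‖z‖ * ‖w‖ : ℝ) * u) - ((1 - ‖z‖ * ‖w‖ : ℝ) : ℂ) * u := by
    push_cast
    ring
  rw [this]
  refine (norm_sub_le _ _).trans (add_le_add le_rfl ?_)
  rw [norm_mul, Complex.norm_real, Real.norm_eq_abs]
  exact mul_le_of_le_one_right (abs_nonneg _) hu1

theorem norm_one_sub_inner_le_direction {z w : Cn n} (hz0 : z ≠ 0) (hw0 : w ≠ 0) :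
    ‖1 - inner ℂ z w‖ ≤
      |1 - ‖z‖ * ‖w‖| + ‖z‖ * ‖w‖ * ‖1 - inner ℂ (direction z) (direction w)‖ := by
  rw [inner_eq_mul_inner_direction hz0 hw0]
  set u := inner ℂ (direction z) (direction w) with hu
  have : 1 - (‖z‖ * ‖w‖ : ℝ) * u = ((1 - ‖z‖ * ‖w‖ : ℝ) : ℂ) + (‖z‖ * ‖w‖ : ℝ) * (1 - u) := by
    push_cast
    ring
  rw [this]
  refine (norm_add_le _ _).trans ?_
  rw [norm_mul, Complex.norm_real, Complex.norm_real, Real.norm_eq_abs, Real.norm_eq_abs,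
    abs_of_nonneg (by positivity : 0 ≤ ‖z‖ * ‖w‖)]

theorem norm_one_sub_inner_direction_le_of_mem_pseudoBall {z w : Cn n} {r : ℝ}
    (hr : r ∈ Ioo (0 : ℝ) 1) (hz : z ∈ unitBall n) (hw : w ∈ pseudoBall z r) (hz0 : z ≠ 0)
    (hw0 : w ≠ 0) :
    ‖1 - inner ℂ (direction z) (direction w)‖ ≤ (8 / (1 - r ^ 2) + 1) * (1 - ‖z‖) := by
  obtain ⟨h1, h2, h3⟩ := le_of_mem_pseudoBall hr hz hw
  have hw1 := mem_unitBall.mp hw.1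
  have hz1 := mem_unitBall.mp hz
  have h4 := norm_one_sub_inner_direction_le hz0 hw0
  have h5 : |1 - ‖z‖ * ‖w‖| ≤ (1 - ‖z‖) + (1 - ‖w‖) := by
    rw [abs_of_nonneg] <;> nlinarith [norm_nonneg z, norm_nonneg w]
  have : (8 / (1 - r ^ 2) + 1) * (1 - ‖z‖)
      = 4 / (1 - r ^ 2) * (1 - ‖z‖) + (1 - ‖z‖ + 4 / (1 - r ^ 2) * (1 - ‖z‖)) := by ring
  linarith

end Geometry

/-! ### Tails of radial weights -/

section Tail

variable {ω : ℝ → ℝ}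

theorem IsRadialWeight.intervalIntegrable (hω : IsRadialWeight ω) {a b : ℝ} (ha : 0 ≤ a)
    (hab : a ≤ b) (hb : b ≤ 1) : IntervalIntegrable ω volume a b := by
  rw [intervalIntegrable_iff_integrableOn_Ico_of_le hab]
  exact hω.integrable.mono_set (Ico_subset_Ico ha hb)

theorem IsRadialWeight.tail_sub_tail (hω : IsRadialWeight ω) {a b : ℝ} (ha : 0 ≤ a)
    (hab : a ≤ b) (hb : b ≤ 1) : tail ω a - tail ω b = ∫ t in a..b, ω t := by
  rw [tail, tail, sub_eq_iff_eq_add]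
  exact (intervalIntegral.integral_add_adjacent_intervals (hω.intervalIntegrable ha hab hb)
    (hω.intervalIntegrable (ha.trans hab) hb le_rfl)).symm

theorem IsRadialWeight.tail_lt_tail (hω : IsRadialWeight ω) {a b : ℝ} (ha : 0 ≤ a)
    (hab : a < b) (hb : b ≤ 1) : tail ω b < tail ω a := by
  rw [← sub_pos, hω.tail_sub_tail ha hab.le hb]
  exact intervalIntegral.intervalIntegral_pos_of_pos_on (hω.intervalIntegrable ha hab.le hb)
    (fun t ht => hω.pos t ⟨ha.trans ht.1.le, ht.2.trans_le hb⟩) hab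

theorem IsRadialWeight.tail_le_tail (hω : IsRadialWeight ω) {a b : ℝ} (ha : 0 ≤ a)
    (hab : a ≤ b) (hb : b ≤ 1) : tail ω b ≤ tail ω a := by
  rcases hab.eq_or_lt with rfl | h
  · exact le_rfl
  · exact (hω.tail_lt_tail ha h hb).le

theorem tail_one : tail ω 1 = 0 := intervalIntegral.integral_same

theorem IsRadialWeight.tail_pos (hω : IsRadialWeight ω) {a : ℝ} (ha : 0 ≤ a) (ha1 : a < 1) :
    0 < tail ω a := by
  simpa [tail_one] using hω.tail_lt_tail ha ha1 le_rfl

theorem IsRadialWeight.continuousOn_tail (hω : IsRadialWeight ω) :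
    ContinuousOn (tail ω) (Icc 0 1) := by
  have h : ContinuousOn (fun r => tail ω 0 - ∫ t in (0 : ℝ)..r, ω t) (uIcc 0 1) :=
    continuousOn_const.sub
      (intervalIntegral.continuousOn_primitive_interval' (hω.intervalIntegrable le_rfl zero_le_one
        le_rfl) left_mem_uIcc)
  rw [uIcc_of_le zero_le_one] at h
  refine h.congr fun r hr => ?_
  change tail ω r = tail ω 0 - ∫ t in (0 : ℝ)..r, ω t
  rw [← hω.tail_sub_tail le_rfl hr.1 hr.2]
  ring

/-- Iterated doubling: tails at points of comparable distance from `1` are comparable. -/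
theorem IsDoubling.exists_tail_le (hω : IsDoubling ω) (A : ℝ) :
    ∃ C : ℝ, 0 < C ∧ ∀ a ∈ Ico (0 : ℝ) 1, ∀ b ∈ Ico (0 : ℝ) 1, 1 - a ≤ A * (1 - b) →
      tail ω a ≤ C * tail ω b := by
  obtain ⟨hr, D, hD, hdoub⟩ := hω
  have key : ∀ m : ℕ, ∃ C : ℝ, 0 < C ∧ ∀ a ∈ Ico (0 : ℝ) 1, ∀ b ∈ Ico (0 : ℝ) 1,
      1 - a ≤ 2 ^ m * (1 - b) → tail ω a ≤ C * tail ω b := by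
    intro m
    induction m with
    | zero =>
      refine ⟨1, one_pos, fun a ha b hb hab => ?_⟩
      rw [one_mul]
      exact hr.tail_le_tail hb.1 (by linarith) ha.2.le
    | succ m ih =>
      obtain ⟨C, hC, ih⟩ := ih
      refine ⟨D * C, mul_pos hD hC, fun a ha b hb hab => ?_⟩
      have h := ih ((1 + a) / 2) ⟨by linarith [ha.1], by linarith [ha.2]⟩ b hb
        (by rw [pow_succ] at hab; linarith)
      calc tail ω a ≤ D * tail ω ((1 + a) / 2) := (hdoub a ha).le
        _ ≤ D * (C * tail ω b) := by gcongr
        _ = D * C * tail ω b := by ring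
  obtain ⟨m, hm⟩ := pow_unbounded_of_one_lt A (one_lt_two)
  obtain ⟨C, hC, h⟩ := key m
  refine ⟨C, hC, fun a ha b hb hab => h a ha b hb (hab.trans ?_)⟩
  have := hb.2
  gcongr

end Tail

/-! ### Regular weights: doubling and K_ω = 1 -/

section Regular

variable {ω : ℝ → ℝ} {C δ : ℝ}

theorem IsRadialWeight.regular_bounds (hω : IsRadialWeight ω) (hC : 0 < C) (hδ : 0 ≤ δ)
    (h : ∀ r ∈ Ioo δ 1, 1 / C < tail ω r / ((1 - r) * ω r) ∧ tail ω r / ((1 - r) * ω r) < C)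
    {r : ℝ} (hr : r ∈ Ioo δ 1) :
    ω r ≤ C * tail ω r / (1 - r) ∧ tail ω r / (C * (1 - r)) ≤ ω r := by
  obtain ⟨h1, h2⟩ := h r hr
  have hr1 : 0 < 1 - r := by linarith [hr.2]
  have hpos := hω.pos r ⟨hδ.trans hr.1.le, hr.2⟩
  rw [div_lt_div_iff₀ hC (by positivity)] at h1
  rw [div_lt_iff₀ (by positivity)] at h2
  constructor
  · rw [le_div_iff₀ hr1]; linarith
  · rw [div_le_iff₀ (by positivity)]; linarith

theorem IsRadialWeight.tail_sub_tail_le_of_regular (hω : IsRadialWeight ω) (hC : 0 < C)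
    (hδ : 0 ≤ δ)
    (h : ∀ r ∈ Ioo δ 1, 1 / C < tail ω r / ((1 - r) * ω r) ∧ tail ω r / ((1 - r) * ω r) < C)
    {r s : ℝ} (hr : δ < r) (hrs : r ≤ s) (hs : s < 1) :
    tail ω r - tail ω s ≤ (s - r) * (C * tail ω r / (1 - s)) := by
  have hr0 : 0 ≤ r := hδ.trans hr.le
  rw [hω.tail_sub_tail hr0 hrs hs.le]
  calc ∫ t in r..s, ω t ≤ ∫ _ in r..s, C * tail ω r / (1 - s) := by
        refine intervalIntegral.integral_mono_on hrs (hω.intervalIntegrable hr0 hrs hs.le)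
          intervalIntegrable_const fun t ht => ?_
        refine (hω.regular_bounds hC hδ h ⟨hr.trans_le ht.1, ht.2.trans_lt hs⟩).1.trans ?_
        have h1 := hω.tail_le_tail hr0 ht.1 (ht.2.trans hs.le)
        have h2 := hω.tail_pos hr0 (hrs.trans_lt hs)
        have := ht.2
        have : 0 < 1 - s := by linarith
        gcongr
    _ = (s - r) * (C * tail ω r / (1 - s)) := by
        rw [intervalIntegral.integral_const, smul_eq_mul]

theorem IsRadialWeight.le_tail_sub_tail_of_regular (hω : IsRadialWeight ω) (hC : 0 < C)
    (hδ : 0 ≤ δ)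
    (h : ∀ r ∈ Ioo δ 1, 1 / C < tail ω r / ((1 - r) * ω r) ∧ tail ω r / ((1 - r) * ω r) < C)
    {r s : ℝ} (hr : δ < r) (hrs : r ≤ s) (hs : s < 1) :
    (s - r) * (tail ω s / (C * (1 - r))) ≤ tail ω r - tail ω s := by
  have hr0 : 0 ≤ r := hδ.trans hr.le
  rw [hω.tail_sub_tail hr0 hrs hs.le]
  calc (s - r) * (tail ω s / (C * (1 - r))) = ∫ _ in r..s, tail ω s / (C * (1 - r)) := by
        rw [intervalIntegral.integral_const, smul_eq_mul]
    _ ≤ ∫ t in r..s, ω t := by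
        refine intervalIntegral.integral_mono_on hrs intervalIntegrable_const
          (hω.intervalIntegrable hr0 hrs hs.le) fun t ht => ?_
        refine le_trans ?_
          (hω.regular_bounds hC hδ h ⟨hr.trans_le ht.1, ht.2.trans_lt hs⟩).2
        have h1 := hω.tail_le_tail (hr0.trans ht.1) ht.2 hs.le
        have h2 := hω.tail_pos (hr0.trans ht.1) (ht.2.trans_lt hs)
        have := ht.1
        have : 0 < 1 - t := by linarith [ht.2]
        gcongr

/-- Contracting the distance to 1 by a factor k close to 1 costs at most half of the tail, and
finitely many such contractions reach a factor 2. For r ≤ δ, where ω is not controlled pointwise,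
monotonicity of the tail suffices. -/
theorem IsRegularWeight.isDoubling (hω : IsRegularWeight ω) : IsDoubling ω := by
  obtain ⟨hr, C, hC, δ, hδ, h⟩ := hω
  refine ⟨hr, ?_⟩
  -- For s = 1-(1-r)/k one has (s-r)/(1-s) = k-1 = 1/(2C), so the loss is at most half of the tail
  -- at r.
  set k : ℝ := 1 + 1 / (2 * C) with hk
  have hk1 : 1 < k := by rw [hk]; linarith [show 0 < 1 / (2 * C) by positivity]
  have step : ∀ r ∈ Ioo δ 1, tail ω r ≤ 2 * tail ω (1 - (1 - r) / k) := by
    intro r hrm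
    have hr1 : 0 < 1 - r := by linarith [hrm.2]
    have hd : (1 - r) / k ≤ 1 - r := div_le_self hr1.le hk1.le
    have hd0 : 0 < (1 - r) / k := by positivity
    have h1 := hr.tail_sub_tail_le_of_regular hC hδ.1.le h (s := 1 - (1 - r) / k) hrm.1
      (by linarith) (by linarith)
    have h2 : (1 - (1 - r) / k - r) * (C * tail ω r / (1 - (1 - (1 - r) / k)))
        = tail ω r / 2 := by
      rw [hk]
      field_simp
      ring
    linarith
  have iter : ∀ m : ℕ, ∀ r ∈ Ioo δ 1, tail ω r ≤ 2 ^ m * tail ω (1 - (1 - r) / k ^ m) := by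
    intro m
    induction m with
    | zero => intro r _; simp
    | succ m ih =>
      intro r hrm
      have hr1 : 0 < 1 - r := by linarith [hrm.2]
      have hd : (1 - r) / k ^ m ≤ 1 - r := div_le_self hr1.le (one_le_pow₀ hk1.le)
      have hd0 : 0 < (1 - r) / k ^ m := by positivity
      have h2 := step (1 - (1 - r) / k ^ m) ⟨by linarith [hrm.1], by linarith⟩
      have h3 : 1 - (1 - (1 - (1 - r) / k ^ m)) / k = 1 - (1 - r) / k ^ (m + 1) := by
        rw [pow_succ, sub_sub_cancel, div_div]
      rw [h3] at h2
      calc tail ω r ≤ 2 ^ m * tail ω (1 - (1 - r) / k ^ m) := ih r hrm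
        _ ≤ 2 ^ m * (2 * tail ω (1 - (1 - r) / k ^ (m + 1))) := by gcongr
        _ = _ := by ring
  obtain ⟨m, hm⟩ := pow_unbounded_of_one_lt 2 hk1
  have hδ1 : 0 < tail ω ((1 + δ) / 2) := hr.tail_pos (by linarith [hδ.1]) (by linarith [hδ.2])
  have h0 : 0 < tail ω 0 := hr.tail_pos le_rfl one_pos
  -- The power serves r > δ and the quotient r ≤ δ; the remaining positive terms make the inequality
  -- strict.
  refine ⟨2 ^ m + tail ω 0 / tail ω ((1 + δ) / 2) + 1, by positivity, fun r hr1 => ?_⟩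
  have hpos : 0 < tail ω ((1 + r) / 2) := hr.tail_pos (by linarith [hr1.1]) (by linarith [hr1.2])
  have hq : 0 < tail ω 0 / tail ω ((1 + δ) / 2) := by positivity
  rcases le_or_gt r δ with hrδ | hrδ
  · have h1 : tail ω r ≤ tail ω 0 / tail ω ((1 + δ) / 2) * tail ω ((1 + r) / 2) := by
      rw [div_mul_eq_mul_div, le_div_iff₀ hδ1]
      have e1 := hr.tail_le_tail le_rfl hr1.1 hr1.2.le
      have e2 := hr.tail_le_tail (a := (1 + r) / 2) (b := (1 + δ) / 2) (by linarith [hr1.1])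
        (by linarith) (by linarith [hδ.2])
      gcongr
    have h2 : 0 < (2 : ℝ) ^ m * tail ω ((1 + r) / 2) := by positivity
    linarith
  · have h1 := iter m r ⟨hrδ, hr1.2⟩
    have hr2 : 0 < 1 - r := by linarith [hr1.2]
    have h3 : (1 - r) / k ^ m ≤ (1 - r) / 2 := by gcongr
    have h4 := hr.tail_le_tail (a := (1 + r) / 2) (b := 1 - (1 - r) / k ^ m)
      (by linarith [hr1.1]) (by linarith) (by linarith [show 0 < (1 - r) / k ^ m by positivity])
    have h5 : (2 : ℝ) ^ m * tail ω (1 - (1 - r) / k ^ m) ≤ 2 ^ m * tail ω ((1 + r) / 2) := by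
      gcongr
    have h6 := mul_pos hq hpos
    linarith

/-- For a regular weight every `K > 1` is an admissible reverse doubling constant. -/
theorem IsRegularWeight.reverseDoublingConstants_eq (hω : IsRegularWeight ω) :
    reverseDoublingConstants ω = Ioi 1 := by
  obtain ⟨hr, C, hC, δ, hδ, h⟩ := hω
  refine Subset.antisymm (fun K hK => hK.1) fun K hK => ⟨hK, ?_⟩
  rw [mem_Ioi] at hK
  have hK0 : 0 < K := by linarith
  have hg0 : ∀ r ∈ Icc 0 δ, r < 1 - (1 - r) / K ∧ 1 - (1 - r) / K < 1 := by
    intro r hrm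
    have hr1 : 0 < 1 - r := by linarith [hrm.2, hδ.2]
    have := div_lt_self hr1 hK
    have : 0 < (1 - r) / K := by positivity
    constructor <;> linarith
  have hcont : ContinuousOn (fun r => tail ω r - tail ω (1 - (1 - r) / K)) (Icc 0 δ) := by
    refine (hr.continuousOn_tail.mono (Icc_subset_Icc le_rfl hδ.2.le)).sub
      (hr.continuousOn_tail.comp (by fun_prop) fun r hrm => ?_)
    exact ⟨hrm.1.trans (hg0 r hrm).1.le, (hg0 r hrm).2.le⟩
  -- On [0,δ] the drop of the tail is continuous and positive, hence bounded below by its minimum μ.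
  obtain ⟨r₀, hr₀, hmin⟩ := isCompact_Icc.exists_isMinOn (nonempty_Icc.mpr hδ.1.le) hcont
  set μ := tail ω r₀ - tail ω (1 - (1 - r₀) / K)
  have hμ : 0 < μ := sub_pos.mpr (hr.tail_lt_tail hr₀.1 (hg0 r₀ hr₀).1 (hg0 r₀ hr₀).2.le)
  have h0 : 0 < tail ω 0 := hr.tail_pos le_rfl one_pos
  have hKi : 0 < 1 - 1 / K := by
    rw [sub_pos, div_lt_one hK0]; exact hK
  -- The first entry serves r ≤ δ. The second serves r > δ, where (s-r)/(1-r) = 1-1/K.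
  refine ⟨1 + min (μ / tail ω 0) ((1 - 1 / K) / C), by
    have : 0 < min (μ / tail ω 0) ((1 - 1 / K) / C) := lt_min (by positivity) (by positivity)
    linarith, fun r hrm => ?_⟩
  have hr1 : 0 < 1 - r := by linarith [hrm.2]
  have hd := div_lt_self hr1 hK
  have hd0 : 0 < (1 - r) / K := by positivity
  set s := 1 - (1 - r) / K with hs
  have hspos : 0 < tail ω s := hr.tail_pos (by linarith [hrm.1]) (by linarith)
  rcases le_or_gt r δ with hrδ | hrδ
  · have h1 : μ ≤ tail ω r - tail ω s := hmin ⟨hrm.1.le, hrδ⟩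
    have h2 : tail ω s ≤ tail ω 0 := hr.tail_le_tail le_rfl (by linarith [hrm.1]) (by linarith)
    have h3 : min (μ / tail ω 0) ((1 - 1 / K) / C) * tail ω s ≤ μ :=
      calc _ ≤ μ / tail ω 0 * tail ω 0 := by
            gcongr
            exact min_le_left _ _
        _ = μ := by field_simp
    linarith
  · have h1 := hr.le_tail_sub_tail_of_regular hC hδ.1.le h (s := s) hrδ (by linarith)
      (by linarith)
    have h2 : (s - r) * (tail ω s / (C * (1 - r))) = (1 - 1 / K) / C * tail ω s := by
      have : s - r = (1 - 1 / K) * (1 - r) := by rw [hs]; ring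
      rw [this]
      field_simp
    have h3 : min (μ / tail ω 0) ((1 - 1 / K) / C) * tail ω s ≤ (1 - 1 / K) / C * tail ω s := by
      gcongr
      exact min_le_right _ _
    linarith

theorem IsRegularWeight.isTwoSidedDoubling (hω : IsRegularWeight ω) : IsTwoSidedDoubling ω :=
  ⟨hω.isDoubling, hω.1, by rw [hω.reverseDoublingConstants_eq]; exact nonempty_Ioi⟩

theorem IsRegularWeight.infReverseDoubling_eq (hω : IsRegularWeight ω) :
    infReverseDoubling ω = 1 := by
  rw [infReverseDoubling, hω.reverseDoublingConstants_eq, csInf_Ioi]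

end Regular

/-! ### Radial integrals with the polar Jacobian -/

section RadialIntegral

variable {ω : ℝ → ℝ}

/-- The constant weight turns the radial estimates into the volume estimates used for caps. -/
theorem isRadialWeight_one : IsRadialWeight fun _ => 1 :=
  ⟨fun _ _ => one_pos, integrableOn_const (by simp)⟩

theorem tail_const_one (a : ℝ) : tail (fun _ => 1) a = 1 - a := by
  simp [tail]

theorem IsRadialWeight.integrableOn_pow_mul (hω : IsRadialWeight ω) (d : ℕ) {a b : ℝ}
    (ha : 0 ≤ a) (hb : b ≤ 1) : IntegrableOn (fun t => t ^ d * ω t) (Ioo a b) := by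
  have h : IntegrableOn ω (Ioo a b) :=
    hω.integrable.mono_set (Ioo_subset_Ico_self.trans (Ico_subset_Ico ha hb))
  refine h.bdd_mul (c := 1) (by fun_prop) ?_
  filter_upwards [ae_restrict_mem measurableSet_Ioo] with t ht
  have : 0 ≤ t := ha.trans ht.1.le
  rw [Real.norm_eq_abs, abs_of_nonneg (by positivity)]
  exact pow_le_one₀ this (ht.2.le.trans hb)

theorem IsRadialWeight.setIntegral_Ioo (hω : IsRadialWeight ω) {a b : ℝ} (ha : 0 ≤ a)
    (hab : a ≤ b) (hb : b ≤ 1) : ∫ t in Ioo a b, ω t = tail ω a - tail ω b := by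
  rw [hω.tail_sub_tail ha hab hb, intervalIntegral.integral_of_le hab, integral_Ioc_eq_integral_Ioo]

theorem IsRadialWeight.integrableOn_Ioo (hω : IsRadialWeight ω) {a b : ℝ} (ha : 0 ≤ a)
    (hb : b ≤ 1) : IntegrableOn ω (Ioo a b) :=
  hω.integrable.mono_set (Ioo_subset_Ico_self.trans (Ico_subset_Ico ha hb))

theorem IsRadialWeight.setIntegral_pow_mul_le (hω : IsRadialWeight ω) (d : ℕ) {a b : ℝ}
    (ha : 0 ≤ a) (hab : a ≤ b) (hb : b ≤ 1) :
    ∫ t in Ioo a b, t ^ d * ω t ≤ tail ω a - tail ω b := by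
  rw [← hω.setIntegral_Ioo ha hab hb]
  refine setIntegral_mono_on (hω.integrableOn_pow_mul d ha hb) (hω.integrableOn_Ioo ha hb)
    measurableSet_Ioo fun t ht => ?_
  have h0 : 0 ≤ t := ha.trans ht.1.le
  have h1 := hω.pos t ⟨h0, ht.2.trans_le hb⟩
  exact mul_le_of_le_one_left h1.le (pow_le_one₀ h0 (ht.2.le.trans hb))

theorem IsRadialWeight.le_setIntegral_pow_mul (hω : IsRadialWeight ω) (d : ℕ) {a b : ℝ}
    (ha : 0 ≤ a) (hab : a ≤ b) (hb : b ≤ 1) :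
    a ^ d * (tail ω a - tail ω b) ≤ ∫ t in Ioo a b, t ^ d * ω t := by
  rw [← hω.setIntegral_Ioo ha hab hb, ← integral_const_mul]
  refine setIntegral_mono_on ((hω.integrableOn_Ioo ha hb).const_mul _)
    (hω.integrableOn_pow_mul d ha hb) measurableSet_Ioo fun t ht => ?_
  have h1 := hω.pos t ⟨ha.trans ht.1.le, ht.2.trans_le hb⟩
  have := ht.1.le
  gcongr

end RadialIntegral

/-! ### Polar sectors and doubling of spherical caps -/

section CapMass

variable {n : ℕ}

/-- The surface measure of the cap `{η : |1 - ⟨η, ζ⟩| ≤ h}` of the unit sphere. -/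
def capMass (ζ : Cn n) (h : ℝ) : ℝ :=
  (volume : Measure (Cn n)).toSphere.real
    {η : Metric.sphere (0 : Cn n) 1 | ‖1 - inner ℂ ζ (η : Cn n)‖ ≤ h}

/-- The points whose norm is in `I` and whose direction is in the cap of size `h` around `ζ`. -/
def capSector (ζ : Cn n) (h : ℝ) (I : Set ℝ) : Set (Cn n) :=
  {z | z ≠ 0 ∧ ‖z‖ ∈ I ∧ ‖1 - inner ℂ ζ (direction z)‖ ≤ h}

theorem measurable_direction : Measurable (direction : Cn n → Cn n) := by
  have : (direction : Cn n → Cn n) = fun z => ‖z‖⁻¹ • z := funext direction_eq_real_smul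
  rw [this]
  exact measurable_norm.inv.smul measurable_id

theorem measurableSet_capSector (ζ : Cn n) (h : ℝ) {I : Set ℝ} (hI : MeasurableSet I) :
    MeasurableSet (capSector ζ h I) := by
  refine (measurableSet_singleton (0 : Cn n)).compl.inter ((measurable_norm hI).inter ?_)
  have hm : Measurable fun z : Cn n => ‖1 - inner ℂ ζ (direction z)‖ := by
    have hc : Continuous fun z : Cn n => ‖1 - inner ℂ ζ z‖ := by fun_prop
    exact hc.measurable.comp measurable_direction
  exact hm measurableSet_Iic

/-- Integration of radial functions over sectors in polar coordinates. -/
theorem setIntegral_capSector [Nontrivial (Cn n)] (ζ : Cn n) (h : ℝ) {I : Set ℝ} (hI : MeasurableSet I)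
    (hI0 : I ⊆ Ioi 0) (f : ℝ → ℝ) :
    ∫ z in capSector ζ h I, f ‖z‖ =
      capMass ζ h * ∫ t in I, t ^ (Module.finrank ℝ (Cn n) - 1) * f t := by
  set d := Module.finrank ℝ (Cn n) - 1 with hd
  set Q : Set (Metric.sphere (0 : Cn n) 1) := {η | ‖1 - inner ℂ ζ (η : Cn n)‖ ≤ h} with hQ
  have hQm : MeasurableSet Q := by
    have hc : Continuous fun η : Metric.sphere (0 : Cn n) 1 => ‖1 - inner ℂ ζ (η : Cn n)‖ := by
      fun_prop
    exact hc.measurable measurableSet_Iic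
  let g : Metric.sphere (0 : Cn n) 1 → ℝ := Q.indicator fun _ => 1
  let k : Ioi (0 : ℝ) → ℝ := fun t => I.indicator f t
  rw [← integral_indicator (measurableSet_capSector ζ h hI)]
  calc ∫ z, (capSector ζ h I).indicator (fun z => f ‖z‖) z
      = ∫ z : ({0}ᶜ : Set (Cn n)), (capSector ζ h I).indicator (fun z => f ‖z‖) z.1
          ∂(volume.comap Subtype.val) := by
        rw [integral_subtype_comap (measurableSet_singleton _).compl
          ((capSector ζ h I).indicator fun z => f ‖z‖), restrict_compl_singleton]
    -- In polar coordinates the integrand is a product of a function of the direction and a function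
    -- of the radius.
    _ = ∫ p, g p.1 * k p.2 ∂((volume : Measure (Cn n)).toSphere.prod (.volumeIoiPow d)) := by
        rw [← (volume : Measure (Cn n)).measurePreserving_homeomorphUnitSphereProd.integral_comp
          (Homeomorph.measurableEmbedding _)]
        refine integral_congr_ae (ae_of_all _ fun z => ?_)
        have hz : (z : Cn n) ≠ 0 := z.2
        have hdir : ‖(z : Cn n)‖⁻¹ • (z : Cn n) = direction (z : Cn n) :=
          (direction_eq_real_smul _).symm
        simp only [g, k, indicator, hQ, mem_ofPred_eq, homeomorphUnitSphereProd_apply_fst_coe,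
          homeomorphUnitSphereProd_apply_snd_coe, hdir, capSector, ne_eq, hz, not_false_eq_true,
          true_and]
        by_cases h1 : ‖(z : Cn n)‖ ∈ I <;>
          by_cases h2 : ‖1 - inner ℂ ζ (direction (z : Cn n))‖ ≤ h <;> simp [h1, h2, hz]
    _ = (∫ η, g η ∂(volume : Measure (Cn n)).toSphere) * ∫ t, k t ∂(.volumeIoiPow d) :=
        integral_prod_mul g k
    _ = _ := by
        congr 1
        · rw [integral_indicator hQm, setIntegral_const, smul_eq_mul, mul_one]
          rfl
        · simp only [Measure.volumeIoiPow, ENNReal.ofReal]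
          rw [integral_withDensity_eq_integral_smul
              (measurable_subtype_coe.pow_const _).real_toNNReal,
            integral_subtype_comap measurableSet_Ioi
              fun a ↦ Real.toNNReal (a ^ d) • I.indicator f a,
            ← inter_eq_right.mpr hI0, ← setIntegral_indicator hI, inter_eq_right.mpr hI0]
          refine setIntegral_congr_fun measurableSet_Ioi fun t ht => ?_
          have : 0 ≤ t := le_of_lt ht
          by_cases h1 : t ∈ I <;> simp [h1, NNReal.smul_def, Real.coe_toNNReal _ (pow_nonneg this d)]

theorem capMass_nonneg (ζ : Cn n) (h : ℝ) : 0 ≤ capMass ζ h := measureReal_nonneg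

theorem capMass_mono (ζ : Cn n) {h k : ℝ} (hk : h ≤ k) : capMass ζ h ≤ capMass ζ k :=
  measureReal_mono fun _ hη => le_trans hη hk

theorem capMass_two_eq {ζ : Cn n} (hζ : ‖ζ‖ = 1) :
    capMass ζ 2 = (volume : Measure (Cn n)).toSphere.real univ := by
  refine congrArg _ (eq_univ_of_forall fun η => ?_)
  have h1 := norm_inner_le_norm (𝕜 := ℂ) ζ (η : Cn n)
  rw [hζ, norm_eq_of_mem_sphere, one_mul] at h1
  have h2 := norm_sub_le (1 : ℂ) (inner ℂ ζ (η : Cn n))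
  rw [norm_one] at h2
  exact h2.trans (by linarith)

theorem capMass_le_capMass_two {ζ : Cn n} (hζ : ‖ζ‖ = 1) (h : ℝ) :
    capMass ζ h ≤ capMass ζ 2 := by
  rw [capMass_two_eq hζ]
  exact measureReal_mono (subset_univ _)

/-- Change of centre, by the quasi-triangle inequality. -/
theorem capMass_le_capMass {ζ ξ : Cn n} (hζ : ‖ζ‖ = 1) (hξ : ‖ξ‖ = 1) (h : ℝ) :
    capMass ζ h ≤ capMass ξ (2 * (‖1 - inner ℂ ξ ζ‖ + h)) := by
  refine measureReal_mono fun η hη => ?_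
  have := norm_one_sub_inner_le hξ hζ (norm_eq_of_mem_sphere η)
  rw [mem_ofPred_eq] at hη
  exact this.trans (by linarith)

theorem volume_real_capSector [Nontrivial (Cn n)] (ζ : Cn n) (h : ℝ) {I : Set ℝ} (hI : MeasurableSet I)
    (hI0 : I ⊆ Ioi 0) :
    volume.real (capSector ζ h I) =
      capMass ζ h * ∫ t in I, t ^ (Module.finrank ℝ (Cn n) - 1) * (1 : ℝ) := by
  rw [← setIntegral_capSector ζ h hI hI0 fun _ => 1, setIntegral_const, smul_eq_mul, mul_one]

/-- The nonisotropic ball of size `h` around `ζ` in the unit ball. -/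
def ballCap (ζ : Cn n) (h : ℝ) : Set (Cn n) :=
  {z | z ∈ unitBall n ∧ ‖1 - inner ℂ ζ z‖ < h}

theorem volume_ne_top_of_subset_unitBall {s : Set (Cn n)} (hs : s ⊆ unitBall n) :
    volume s ≠ ⊤ :=
  ((measure_mono hs).trans_lt Metric.isBounded_ball.measure_lt_top).ne

/-- Dilation towards `ζ` maps one cap into a smaller one. -/
theorem pow_mul_volume_ballCap_le {ζ : Cn n} (hζ : ‖ζ‖ = 1) {s : ℝ} (hs : s ∈ Ioc (0 : ℝ) 1)
    (h : ℝ) :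
    s ^ Module.finrank ℝ (Cn n) * volume.real (ballCap ζ h) ≤ volume.real (ballCap ζ (s * h)) := by
  have hsub : AffineMap.homothety ζ s '' ballCap ζ h ⊆ ballCap ζ (s * h) := by
    rintro _ ⟨z, ⟨hz, hzh⟩, rfl⟩
    rw [mem_unitBall] at hz
    have hval : AffineMap.homothety ζ s z = (1 - s) • ζ + s • z := by
      rw [AffineMap.homothety_apply, vsub_eq_sub, vadd_eq_add, sub_smul, one_smul, smul_sub]
      abel
    rw [hval]
    refine ⟨mem_unitBall.mpr ?_, ?_⟩
    · calc ‖(1 - s) • ζ + s • z‖ ≤ ‖(1 - s) • ζ‖ + ‖s • z‖ := norm_add_le _ _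
        _ = (1 - s) + s * ‖z‖ := by
          rw [norm_smul, norm_smul, hζ, Real.norm_of_nonneg (by linarith [hs.2]),
            Real.norm_of_nonneg hs.1.le, mul_one]
        _ < 1 := by nlinarith [hs.1]
    -- Because ⟨ζ,ζ⟩ = 1, the homothety scales 1-⟨z,ζ⟩ by exactly s.
    · have : 1 - inner ℂ ζ ((1 - s) • ζ + s • z) = (s : ℂ) * (1 - inner ℂ ζ z) := by
        rw [inner_add_right, inner_smul_right_eq_smul, inner_smul_right_eq_smul,
          inner_self_eq_norm_sq_to_K, hζ]
        simp
        ring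
      rw [this, norm_mul, Complex.norm_real, Real.norm_of_nonneg hs.1.le]
      exact mul_lt_mul_of_pos_left hzh hs.1
  have h1 := measureReal_mono (μ := volume) hsub
    (volume_ne_top_of_subset_unitBall fun z hz => hz.1)
  rw [measureReal_def, Measure.addHaar_image_homothety, ENNReal.toReal_mul,
    ENNReal.toReal_ofReal (abs_nonneg _), abs_of_nonneg (pow_nonneg hs.1.le _)] at h1
  exact h1

/-- A sector of height h/4 over the cap fits into the ball cap of size 2h; as h ≤ 2, its radii
exceed 1/2. Together with `volume_ballCap_le` this lets the scaling of volume pass to surface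
measure. -/
theorem mul_capMass_le_volume_ballCap [Nontrivial (Cn n)] {ζ : Cn n} {h : ℝ} (hh : h ∈ Ioc (0 : ℝ) 2) :
    (1 / 2) ^ (Module.finrank ℝ (Cn n) - 1) * (h / 4) * capMass ζ h
      ≤ volume.real (ballCap ζ (2 * h)) := by
  obtain ⟨h0, h2⟩ := hh
  have hsub : capSector ζ h (Ioo (1 - h / 4) 1) ⊆ ballCap ζ (2 * h) := by
    rintro z ⟨hz0, hzI, hz⟩
    refine ⟨mem_unitBall.mpr hzI.2, ?_⟩
    have hval : 1 - inner ℂ ζ z =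
        ((1 - ‖z‖ : ℝ) : ℂ) + (‖z‖ : ℂ) * (1 - inner ℂ ζ (direction z)) := by
      conv_lhs => rw [← norm_smul_direction hz0, inner_smul_right]
      push_cast
      ring
    rw [hval]
    refine (norm_add_le _ _).trans_lt ?_
    rw [norm_mul, Complex.norm_real, Complex.norm_real, norm_norm,
      Real.norm_of_nonneg (by linarith [hzI.2])]
    nlinarith [hzI.1, hzI.2, norm_nonneg z, norm_nonneg (1 - inner ℂ ζ (direction z))]
  have h1 := measureReal_mono (μ := volume) hsub
    (volume_ne_top_of_subset_unitBall fun z hz => hz.1)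
  rw [volume_real_capSector ζ h measurableSet_Ioo fun t ht => mem_Ioi.mpr (by linarith [ht.1])]
    at h1
  refine le_trans ?_ h1
  rw [mul_comm]
  refine mul_le_mul_of_nonneg_left ?_ (capMass_nonneg ζ h)
  have h3 := isRadialWeight_one.le_setIntegral_pow_mul (Module.finrank ℝ (Cn n) - 1)
    (a := 1 - h / 4) (b := 1) (by linarith) (by linarith) le_rfl
  rw [tail_const_one, tail_const_one] at h3
  refine le_trans ?_ h3
  rw [sub_self, sub_zero, sub_sub_cancel]
  gcongr
  linarith

/-- Being within h of ζ forces 1-|z| < h, and normalizing z costs at most another h. -/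
theorem volume_ballCap_le [Nontrivial (Cn n)] {ζ : Cn n} (hζ : ‖ζ‖ = 1) {h : ℝ} (hh : h ∈ Ioc (0 : ℝ) 1) :
    volume.real (ballCap ζ h) ≤ h * capMass ζ (2 * h) := by
  obtain ⟨h0, h1⟩ := hh
  have hsub : ballCap ζ h ⊆ capSector ζ (2 * h) (Ioo (1 - h) 1) := by
    rintro z ⟨hz, hzh⟩
    rw [mem_unitBall] at hz
    have h2 := one_sub_norm_mul_norm_le ζ z
    rw [hζ, one_mul] at h2
    have hz0 : z ≠ 0 := by
      rintro rfl
      rw [norm_zero] at h2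
      linarith
    refine ⟨hz0, ⟨by linarith, hz⟩, ?_⟩
    have hu : ‖inner ℂ ζ (direction z)‖ ≤ 1 := by
      simpa [hζ, norm_direction hz0] using norm_inner_le_norm (𝕜 := ℂ) ζ (direction z)
    have hval : 1 - inner ℂ ζ (direction z) =
        (1 - inner ℂ ζ z) - ((1 - ‖z‖ : ℝ) : ℂ) * inner ℂ ζ (direction z) := by
      have : inner ℂ ζ z = (‖z‖ : ℂ) * inner ℂ ζ (direction z) := by
        conv_lhs => rw [← norm_smul_direction hz0, inner_smul_right]
      rw [this]
      push_cast
      ring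
    rw [hval]
    refine (norm_sub_le _ _).trans ?_
    rw [norm_mul, Complex.norm_real, Real.norm_of_nonneg (by linarith)]
    nlinarith
  have hfin : capSector ζ (2 * h) (Ioo (1 - h) 1) ⊆ unitBall n :=
    fun z hz => mem_unitBall.mpr hz.2.1.2
  refine (measureReal_mono hsub (volume_ne_top_of_subset_unitBall hfin)).trans ?_
  rw [volume_real_capSector ζ _ measurableSet_Ioo fun t ht => mem_Ioi.mpr (by linarith [ht.1]),
    mul_comm]
  refine mul_le_mul_of_nonneg_right ?_ (capMass_nonneg ζ _)
  have h3 := isRadialWeight_one.setIntegral_pow_mul_le (Module.finrank ℝ (Cn n) - 1)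
    (a := 1 - h) (b := 1) (by linarith) (by linarith) le_rfl
  rw [tail_const_one, tail_const_one] at h3
  linarith

/-- Doubling of the surface measure of nonisotropic caps. -/
theorem exists_capMass_le (n : ℕ) [Nontrivial (Cn n)] (B : ℝ) :
    ∃ C : ℝ, 0 < C ∧ ∀ ζ : Cn n, ‖ζ‖ = 1 → ∀ h k : ℝ, 0 < k → h ≤ B * k →
      capMass ζ h ≤ C * capMass ζ k := by
  wlog hB : 1 ≤ B generalizing B
  · obtain ⟨C, hC, h1⟩ := this 1 le_rfl
    refine ⟨C, hC, fun ζ hζ h k hk hhk => h1 ζ hζ h k hk (hhk.trans ?_)⟩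
    gcongr
    linarith
  set D := Module.finrank ℝ (Cn n) with hD
  set P : ℝ := (1 / 2) ^ (D - 1) * (1 / 4) with hP
  -- A surface cap of size h passes to a ball cap of size 2h, is shrunk by s and returns as a
  -- surface cap of size 4sh. For h = Bk this is k.
  set s : ℝ := 1 / (4 * B) with hs
  have hP0 : 0 < P := by positivity
  have hs0 : 0 < s := by positivity
  have hs1 : s ≤ 1 / 4 := by
    rw [hs]
    gcongr
    linarith
  have hsB : s * B = 1 / 4 := by rw [hs]; field_simp
  have key : ∀ ζ : Cn n, ‖ζ‖ = 1 → ∀ h ∈ Ioc (0 : ℝ) 2,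
      capMass ζ h ≤ 2 * s / (P * s ^ D) * capMass ζ (4 * s * h) := by
    intro ζ hζ h hh
    have h1 := mul_capMass_le_volume_ballCap (ζ := ζ) hh
    have h2 := pow_mul_volume_ballCap_le hζ ⟨hs0, by linarith⟩ (2 * h)
    have h3 := volume_ballCap_le hζ (h := s * (2 * h))
      ⟨by have := hh.1; positivity, by nlinarith [hh.1, hh.2]⟩
    rw [show 2 * (s * (2 * h)) = 4 * s * h by ring] at h3
    have h4 : s ^ D * (P * h * capMass ζ h) ≤ s * (2 * h) * capMass ζ (4 * s * h) := by
      refine le_trans ?_ (h2.trans h3)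
      gcongr
      refine le_trans (le_of_eq ?_) h1
      rw [hP]
      ring
    rw [div_mul_eq_mul_div, le_div_iff₀ (by positivity)]
    have h5 : h * (capMass ζ h * (P * s ^ D)) ≤ h * (2 * s * capMass ζ (4 * s * h)) := by
      linarith
    exact le_of_mul_le_mul_left h5 hh.1
  refine ⟨2 * s / (P * s ^ D), by positivity, fun ζ hζ h k hk hhk => ?_⟩
  have hkB : k = 4 * s * (B * k) := by
    linear_combination (-4 * k) * hsB
  -- Caps of size at least 2 are the whole sphere, so size 2 suffices when Bk > 2.
  rcases le_or_gt (B * k) 2 with hle | hgt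
  · refine (capMass_mono ζ hhk).trans ((key ζ hζ (B * k) ⟨by positivity, hle⟩).trans ?_)
    rw [← hkB]
  · refine (capMass_le_capMass_two hζ h).trans ((key ζ hζ 2 ⟨two_pos, le_rfl⟩).trans ?_)
    refine mul_le_mul_of_nonneg_left (capMass_mono ζ ?_) (by positivity)
    rw [hkB]
    gcongr

end CapMass

/-! ### Weighted masses of Carleson blocks and pseudo-hyperbolic balls -/

section WeightedMass

variable {n : ℕ} {ω : ℝ → ℝ}

theorem weightedMass_eq {E : Set (Cn n)} (hE : E ⊆ unitBall n) :
    weightedMass ω E = (volume.real (unitBall n))⁻¹ * ∫ z in E, ω ‖z‖ := by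
  rw [weightedMass, ballMeasure, Measure.restrict_smul, Measure.restrict_restrict_of_subset hE,
    integral_smul_measure, ENNReal.toReal_inv, smul_eq_mul]
  rfl

theorem IsRadialWeight.integrableOn_norm [Nontrivial (Cn n)] (hω : IsRadialWeight ω) :
    IntegrableOn (fun z : Cn n => ω ‖z‖) (unitBall n) :=
  (integrableOn_fun_norm_addHaar volume).mpr (hω.integrableOn_pow_mul _ le_rfl le_rfl)

theorem IsRadialWeight.ae_nonneg (hω : IsRadialWeight ω) {E : Set (Cn n)} (hE : E ⊆ unitBall n) :
    0 ≤ᵐ[volume.restrict E] fun z => ω ‖z‖ := by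
  refine ae_mono (Measure.restrict_mono_set _ hE) ?_
  have hm : MeasurableSet (unitBall n) := measurableSet_ball
  filter_upwards [ae_restrict_mem hm] with z hz
  exact (hω.pos _ ⟨norm_nonneg z, mem_unitBall.mp hz⟩).le

theorem IsRadialWeight.weightedMass_mono [Nontrivial (Cn n)] (hω : IsRadialWeight ω)
    {E F : Set (Cn n)} (hEF : E ⊆ F) (hF : F ⊆ unitBall n) :
    weightedMass ω E ≤ weightedMass ω F := by
  rw [weightedMass_eq (hEF.trans hF), weightedMass_eq hF]
  refine mul_le_mul_of_nonneg_left ?_ (inv_nonneg.mpr measureReal_nonneg)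
  exact setIntegral_mono_set (hω.integrableOn_norm.mono_set hF) (hω.ae_nonneg hF)
    hEF.eventuallyLE

theorem volume_real_unitBall_pos (n : ℕ) : 0 < volume.real (unitBall n) :=
  ENNReal.toReal_pos (Metric.measure_ball_pos volume _ one_pos).ne'
    Metric.isBounded_ball.measure_lt_top.ne

theorem IsRadialWeight.weightedMass_ball_pos [Nontrivial (Cn n)] (hω : IsRadialWeight ω)
    {z : Cn n} {ε : ℝ} (hε : 0 < ε) (hz : Metric.ball z ε ⊆ unitBall n) :
    0 < weightedMass ω (Metric.ball z ε) := by
  rw [weightedMass_eq hz]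
  refine mul_pos (inv_pos.mpr (volume_real_unitBall_pos n)) ?_
  rw [setIntegral_pos_iff_support_of_nonneg_ae (hω.ae_nonneg hz)
    (hω.integrableOn_norm.mono_set hz)]
  have : Metric.ball z ε ⊆ Function.support (fun z : Cn n => ω ‖z‖) ∩ Metric.ball z ε :=
    fun w hw => ⟨(hω.pos _ ⟨norm_nonneg w, mem_unitBall.mp (hz hw)⟩).ne', hw⟩
  exact (Metric.measure_ball_pos volume z hε).trans_le (measure_mono this)

theorem capSector_subset_unitBall (ζ : Cn n) (h : ℝ) {a b : ℝ} (hb : b ≤ 1) :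
    capSector ζ h (Ioo a b) ⊆ unitBall n :=
  fun _ hz => mem_unitBall.mpr (hz.2.1.2.trans_le hb)

theorem IsRadialWeight.weightedMass_capSector_le [Nontrivial (Cn n)] (hω : IsRadialWeight ω)
    (ζ : Cn n) (h : ℝ) {a b : ℝ} (ha : 0 ≤ a) (hab : a ≤ b) (hb : b ≤ 1) :
    weightedMass ω (capSector ζ h (Ioo a b)) ≤
      (volume.real (unitBall n))⁻¹ * (capMass ζ h * (tail ω a - tail ω b)) := by
  rw [weightedMass_eq (capSector_subset_unitBall ζ h hb), setIntegral_capSector ζ h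
    measurableSet_Ioo fun t ht => ha.trans_lt ht.1]
  have h1 := hω.setIntegral_pow_mul_le (Module.finrank ℝ (Cn n) - 1) ha hab hb
  have h2 := (volume_real_unitBall_pos n).le
  have h3 := capMass_nonneg ζ h
  gcongr

/-- Radii of at least 1/2 keep the polar Jacobian away from zero. -/
theorem IsRadialWeight.le_weightedMass_capSector [Nontrivial (Cn n)] (hω : IsRadialWeight ω)
    (ζ : Cn n) (h : ℝ) {a b : ℝ} (ha : 1 / 2 ≤ a) (hab : a ≤ b) (hb : b ≤ 1) :
    (volume.real (unitBall n))⁻¹ * (capMass ζ h * (tail ω a - tail ω b)) ≤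
      2 ^ (Module.finrank ℝ (Cn n) - 1) * weightedMass ω (capSector ζ h (Ioo a b)) := by
  have ha0 : 0 ≤ a := by linarith
  rw [weightedMass_eq (capSector_subset_unitBall ζ h hb), setIntegral_capSector ζ h
    measurableSet_Ioo fun t ht => ha0.trans_lt ht.1]
  have h1 := hω.le_setIntegral_pow_mul (Module.finrank ℝ (Cn n) - 1) ha0 hab hb
  set d := Module.finrank ℝ (Cn n) - 1
  have h2 := (volume_real_unitBall_pos n).le
  have h3 := capMass_nonneg ζ h
  have h4 : 0 ≤ tail ω a - tail ω b := sub_nonneg.mpr (hω.tail_le_tail ha0 hab hb)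
  have h5 : tail ω a - tail ω b ≤ 2 ^ d * ∫ t in Ioo a b, t ^ d * ω t :=
    calc tail ω a - tail ω b = 2 ^ d * ((1 / 2) ^ d * (tail ω a - tail ω b)) := by
          rw [← mul_assoc, ← mul_pow]; norm_num
      _ ≤ 2 ^ d * (a ^ d * (tail ω a - tail ω b)) := by gcongr
      _ ≤ _ := by gcongr
  calc _ ≤ (volume.real (unitBall n))⁻¹ *
        (capMass ζ h * (2 ^ d * ∫ t in Ioo a b, t ^ d * ω t)) := by gcongr
    _ = _ := by ring

/-- The square roots on the two sides cancel, so the block is a polar sector. -/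
theorem carlesonBlock_eq {a : Cn n} (ha : a ≠ 0) :
    carlesonBlock a = capSector (direction a) (1 - ‖a‖) (Ioo ‖a‖ 1) := by
  ext z
  rw [carlesonBlock, if_neg ha]
  constructor
  · rintro ⟨hz, haz, -, hd⟩
    refine ⟨norm_pos_iff.mp ((norm_nonneg a).trans_lt haz), ⟨haz, mem_unitBall.mp hz⟩, ?_⟩
    rw [mem_unitBall] at hz
    rw [nonisoDist, Real.sqrt_le_sqrt_iff (by linarith)] at hd
    rwa [norm_one_sub_inner_comm]
  · rintro ⟨hz0, ⟨haz, hz⟩, hd⟩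
    refine ⟨mem_unitBall.mpr hz, haz, by simp [norm_direction hz0], ?_⟩
    rw [nonisoDist, Real.sqrt_le_sqrt_iff (by linarith)]
    rwa [norm_one_sub_inner_comm]

theorem carlesonBlock_zero : carlesonBlock (0 : Cn n) = unitBall n := if_pos rfl

theorem carlesonBlock_subset_unitBall (a : Cn n) : carlesonBlock a ⊆ unitBall n := by
  rcases eq_or_ne a 0 with rfl | ha
  · rw [carlesonBlock_zero]
  · rw [carlesonBlock_eq ha]
    exact capSector_subset_unitBall _ _ le_rfl

theorem pseudoBall_subset_unitBall (z : Cn n) (r : ℝ) : pseudoBall z r ⊆ unitBall n :=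
  fun _ hw => hw.1

theorem IsRadialWeight.weightedMass_nonneg (hω : IsRadialWeight ω) {E : Set (Cn n)}
    (hE : E ⊆ unitBall n) : 0 ≤ weightedMass ω E := by
  rw [weightedMass_eq hE]
  exact mul_nonneg (inv_nonneg.mpr measureReal_nonneg) (integral_nonneg_of_ae (hω.ae_nonneg hE))

/-- The common size of the blocks at `z ≠ 0`. -/
def blockSize (ω : ℝ → ℝ) (z : Cn n) : ℝ :=
  (volume.real (unitBall n))⁻¹ * (capMass (direction z) (1 - ‖z‖) * tail ω ‖z‖)

theorem IsRadialWeight.weightedMass_carlesonBlock_le [Nontrivial (Cn n)]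
    (hω : IsRadialWeight ω) {z : Cn n} (hz0 : z ≠ 0) (hz : ‖z‖ < 1) :
    weightedMass ω (carlesonBlock z) ≤ blockSize ω z := by
  rw [carlesonBlock_eq hz0, blockSize]
  simpa [tail_one] using hω.weightedMass_capSector_le (direction z) (1 - ‖z‖) (norm_nonneg z)
    hz.le le_rfl

theorem IsDoubling.exists_blockSize_le_carlesonBlock [Nontrivial (Cn n)] (hω : IsDoubling ω) :
    ∃ C : ℝ, 0 < C ∧ ∀ z : Cn n, z ≠ 0 → ‖z‖ < 1 →
      blockSize ω z ≤ C * weightedMass ω (carlesonBlock z) := by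
  obtain ⟨C, hC, hCt⟩ := hω.exists_tail_le 2
  refine ⟨C * 2 ^ (Module.finrank ℝ (Cn n) - 1), by positivity, fun z hz0 hz => ?_⟩
  -- The sector is cut off at radius 1/2 because of the Jacobian; since 1-|z| ≤ 2(1-a), doubling
  -- recovers the lost tail.
  set a := max ‖z‖ (1 / 2) with ha
  have ha2 : 1 / 2 ≤ a := le_max_right _ _
  have ha1 : a < 1 := max_lt hz (by norm_num)
  have h1 : tail ω ‖z‖ ≤ C * tail ω a := by
    refine hCt _ ⟨norm_nonneg z, hz⟩ _ ⟨by linarith, ha1⟩ ?_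
    rcases max_choice ‖z‖ (1 / 2) with h | h <;> rw [ha, h] <;> linarith [norm_nonneg z]
  have h2 := hω.1.le_weightedMass_capSector (direction z) (1 - ‖z‖) ha2 ha1.le le_rfl
  rw [tail_one, sub_zero] at h2
  have h3 : weightedMass ω (capSector (direction z) (1 - ‖z‖) (Ioo a 1)) ≤
      weightedMass ω (carlesonBlock z) := by
    rw [carlesonBlock_eq hz0]
    refine hω.1.weightedMass_mono ?_ (capSector_subset_unitBall _ _ le_rfl)
    exact fun w hw => ⟨hw.1, ⟨(le_max_left _ _).trans_lt hw.2.1.1, hw.2.1.2⟩, hw.2.2⟩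
  have h4 := (volume_real_unitBall_pos n).le
  have h5 := capMass_nonneg (direction z) (1 - ‖z‖)
  calc blockSize ω z ≤ (volume.real (unitBall n))⁻¹ *
        (capMass (direction z) (1 - ‖z‖) * (C * tail ω a)) := by
        rw [blockSize]; gcongr
    _ = C * ((volume.real (unitBall n))⁻¹ *
        (capMass (direction z) (1 - ‖z‖) * tail ω a)) := by ring
    _ ≤ C * (2 ^ (Module.finrank ℝ (Cn n) - 1) *
        weightedMass ω (capSector (direction z) (1 - ‖z‖) (Ioo a 1))) := by gcongr
    _ ≤ C * (2 ^ (Module.finrank ℝ (Cn n) - 1) * weightedMass ω (carlesonBlock z)) := by gcongr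
    _ = _ := by ring

theorem IsDoubling.exists_blockSize_le_blockSize [Nontrivial (Cn n)] (hω : IsDoubling ω)
    (A B : ℝ) :
    ∃ C : ℝ, 0 < C ∧ ∀ z w : Cn n, z ≠ 0 → w ≠ 0 → ‖z‖ < 1 → ‖w‖ < 1 →
      1 - ‖z‖ ≤ A * (1 - ‖w‖) →
      ‖1 - inner ℂ (direction w) (direction z)‖ ≤ B * (1 - ‖w‖) →
      blockSize ω z ≤ C * blockSize ω w := by
  obtain ⟨C, hC, hCt⟩ := hω.exists_tail_le A
  -- Moving the centre from z/|z| to w/|w| turns size 1-|z| into at most 2(B+A)(1-|w|).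
  obtain ⟨D, hD, hDc⟩ := exists_capMass_le n (2 * (B + A))
  refine ⟨D * C, by positivity, fun z w hz0 hw0 hz hw hA hB => ?_⟩
  have h1 := hCt _ ⟨norm_nonneg z, hz⟩ _ ⟨norm_nonneg w, hw⟩ hA
  have h2 : capMass (direction z) (1 - ‖z‖) ≤ D * capMass (direction w) (1 - ‖w‖) :=
    (capMass_le_capMass (norm_direction hz0) (norm_direction hw0) _).trans
      (hDc _ (norm_direction hw0) _ _ (by linarith) (by linarith))
  have h3 := (volume_real_unitBall_pos n).le
  have h4 := capMass_nonneg (direction w) (1 - ‖w‖)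
  have h5 := (hω.1.tail_pos (norm_nonneg z) hz).le
  calc blockSize ω z ≤ (volume.real (unitBall n))⁻¹ *
        (D * capMass (direction w) (1 - ‖w‖) * (C * tail ω ‖w‖)) := by
        rw [blockSize]; gcongr
    _ = _ := by rw [blockSize]; ring

/-- Upper bound for pseudo-hyperbolic balls near the boundary. -/
theorem IsDoubling.exists_pseudoBall_le_blockSize [Nontrivial (Cn n)] (hω : IsDoubling ω) {r : ℝ}
    (hr : r ∈ Ioo (0 : ℝ) 1) :
    ∃ c : ℝ, 0 < c ∧ ∃ C : ℝ, 0 < C ∧ ∀ z : Cn n, z ≠ 0 → ‖z‖ < 1 → 1 - ‖z‖ ≤ c →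
      weightedMass ω (pseudoBall z r) ≤ C * blockSize ω z := by
  have hr2 : 0 < 1 - r ^ 2 := by nlinarith [hr.1, hr.2]
  set A := 4 / (1 - r ^ 2) with hA
  have hA0 : 0 < A := by positivity
  obtain ⟨C, hC, hCt⟩ := hω.exists_tail_le (2 * A)
  obtain ⟨D, hD, hDc⟩ := exists_capMass_le n (8 / (1 - r ^ 2) + 1)
  -- This threshold makes 2A(1-|z|) ≤ 1, so the inner radius a is nonnegative and Δ(z,r) avoids the
  -- origin. The factor 2 gives the strict inequality a < |w|.
  refine ⟨1 / (2 * A), by positivity, D * C, by positivity, fun z hz0 hz hzc => ?_⟩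
  have hAx : 2 * A * (1 - ‖z‖) ≤ 1 := by
    rw [le_div_iff₀ (by positivity)] at hzc
    linarith
  set a := 1 - 2 * A * (1 - ‖z‖) with ha
  have hx : 0 < 1 - ‖z‖ := by linarith
  have hAx0 : 0 < A * (1 - ‖z‖) := by positivity
  have hsub : pseudoBall z r ⊆
      capSector (direction z) ((8 / (1 - r ^ 2) + 1) * (1 - ‖z‖)) (Ioo a 1) := by
    intro w hw
    have hw1 := mem_unitBall.mp hw.1
    have h1 := (le_of_mem_pseudoBall hr (mem_unitBall.mpr hz) hw).1
    have hw0 : w ≠ 0 := by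
      rintro rfl
      rw [norm_zero] at h1
      linarith
    exact ⟨hw0, ⟨by linarith, hw1⟩,
      norm_one_sub_inner_direction_le_of_mem_pseudoBall hr (mem_unitBall.mpr hz) hw hz0 hw0⟩
  refine (hω.1.weightedMass_mono hsub (capSector_subset_unitBall _ _ le_rfl)).trans ?_
  refine (hω.1.weightedMass_capSector_le _ _ (by linarith) (by linarith) le_rfl).trans ?_
  rw [tail_one, sub_zero]
  have h1 : tail ω a ≤ C * tail ω ‖z‖ :=
    hCt _ ⟨by linarith, by linarith⟩ _ ⟨norm_nonneg z, hz⟩ (by linarith)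
  have h2 := hDc _ (norm_direction hz0) _ _ hx le_rfl
  have h3 := (volume_real_unitBall_pos n).le
  have h4 := capMass_nonneg (direction z) (1 - ‖z‖)
  have h5 := (hω.1.tail_pos (a := a) (by linarith) (by linarith)).le
  calc _ ≤ (volume.real (unitBall n))⁻¹ *
        (D * capMass (direction z) (1 - ‖z‖) * (C * tail ω ‖z‖)) := by gcongr
    _ = _ := by rw [blockSize]; ring

/-- With x = 1-|z| and y = 1-|w|, to leading order |1-⟨w,z⟩| is x+y and (1-|z|²)(1-|w|²) is 4xy. For
y/x between 1/k and k membership then amounts to (1+k)²(1-r²)/(4k) < 1; `hc` is this condition with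
room for the angular width and the lower-order terms. -/
theorem capSector_subset_pseudoBall {r k c : ℝ} (hr : r ∈ Ioo (0 : ℝ) 1) (hk : 1 < k)
    (hc0 : 0 < c) (hc : (1 + c) ^ 2 * ((1 + k) ^ 2 * (1 - r ^ 2) / (4 * k)) < 1 - k * c)
    {z : Cn n} (hz0 : z ≠ 0) (hz : ‖z‖ < 1) (hzc : 1 - ‖z‖ ≤ c) :
    capSector (direction z) (c * (1 - ‖z‖)) (Ioo (1 - k * (1 - ‖z‖)) (1 - (1 - ‖z‖) / k)) ⊆
      pseudoBall z r := by
  rintro w ⟨hw0, ⟨hwl, hwu⟩, hwd⟩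
  have hx : 0 < 1 - ‖z‖ := by linarith
  have hk0 : 0 < k := by linarith
  have hxk : 0 < (1 - ‖z‖) / k := by positivity
  have hw : ‖w‖ < 1 := by linarith
  refine ⟨mem_unitBall.mpr hw, ?_⟩
  rw [pseudoDist_lt_iff hz hw hr.1]
  have hq := norm_one_sub_inner_le_direction hz0 hw0
  have hr2 : 0 < 1 - r ^ 2 := by nlinarith [hr.1, hr.2]
  have hzn := norm_nonneg z
  have hwn := norm_nonneg w
  rw [abs_of_nonneg (by nlinarith)] at hq
  set q := ‖1 - inner ℂ z w‖ with hqdef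
  have hq0 : 0 ≤ q := norm_nonneg _
  have hxy : (1 - ‖z‖) < k * (1 - ‖w‖) := by
    have : (1 - ‖z‖) / k < 1 - ‖w‖ := by linarith
    rwa [div_lt_iff₀ hk0, mul_comm] at this
  obtain ⟨x, hxdef⟩ : ∃ x, x = 1 - ‖z‖ := ⟨_, rfl⟩
  obtain ⟨y, hydef⟩ : ∃ y, y = 1 - ‖w‖ := ⟨_, rfl⟩
  have hzx : ‖z‖ = 1 - x := by linarith
  have hwy : ‖w‖ = 1 - y := by linarith
  rw [← hxdef] at hx hxy hwd hzc hwl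
  rw [← hydef] at hxy
  have hy : 0 < y := by linarith
  have hyx : y < k * x := by linarith
  have hq1 : q ≤ (1 + c) * (x + y) := by
    have h1 : ‖z‖ * ‖w‖ * ‖1 - inner ℂ (direction z) (direction w)‖ ≤ c * x := by
      refine (mul_le_of_le_one_left (norm_nonneg _) ?_).trans hwd
      nlinarith
    rw [hzx, hwy] at hq h1
    nlinarith [mul_pos hx hy, mul_pos hc0 hy]
  -- The difference of the two sides is (kx-y)(ky-x).
  have h2 : (x + y) ^ 2 * k ≤ (1 + k) ^ 2 * (x * y) := by
    nlinarith [mul_pos (sub_pos.mpr hyx) (sub_pos.mpr hxy)]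
  set θ := (1 + k) ^ 2 * (1 - r ^ 2) / (4 * k) with hθ
  have h3 : (x + y) ^ 2 * (1 - r ^ 2) ≤ 4 * θ * (x * y) := by
    have : 4 * θ * (x * y) = ((1 + k) ^ 2 * (x * y)) * (1 - r ^ 2) / k := by
      rw [hθ]; field_simp
    rw [this, le_div_iff₀ hk0]
    nlinarith
  have hxy0 : 0 < x * y := mul_pos hx hy
  calc q ^ 2 * (1 - r ^ 2) ≤ ((1 + c) * (x + y)) ^ 2 * (1 - r ^ 2) := by gcongr
    _ = (1 + c) ^ 2 * ((x + y) ^ 2 * (1 - r ^ 2)) := by ring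
    _ ≤ (1 + c) ^ 2 * (4 * θ * (x * y)) := by gcongr
    _ = ((1 + c) ^ 2 * θ) * (4 * (x * y)) := by ring
    _ < (1 - k * c) * (4 * (x * y)) := by gcongr
    -- Here x ≤ c and y < kx give (x+y)/2 ≤ kc.
    _ ≤ (1 - (x + y) / 2 + x * y / 4) * (4 * (x * y)) := by
      gcongr
      nlinarith
    _ = (1 - ‖z‖ ^ 2) * (1 - ‖w‖ ^ 2) := by
      rw [hzx, hwy]
      ring

/-- Lower bound for pseudo-hyperbolic balls near the boundary; the reverse doubling constant has
to fit into the radial extent of the ball. -/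
theorem IsDoubling.exists_blockSize_le_pseudoBall [Nontrivial (Cn n)] (hω : IsDoubling ω)
    {r K : ℝ} (hr : r ∈ Ioo (0 : ℝ) 1) (hK : K ∈ reverseDoublingConstants ω)
    (hKr : K * (1 - r) ^ 2 < (1 + r) ^ 2) :
    ∃ c : ℝ, 0 < c ∧ ∃ C : ℝ, 0 < C ∧ ∀ z : Cn n, z ≠ 0 → ‖z‖ < 1 → 1 - ‖z‖ ≤ c →
      blockSize ω z ≤ C * weightedMass ω (pseudoBall z r) := by
  obtain ⟨hK1, M, hM, hrev⟩ := hK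
  -- With k² = K, the ends of the radial range (1-kx, 1-x/k) have distances to 1 in ratio K, as
  -- reverse doubling requires.
  obtain ⟨k, hk, hkK⟩ : ∃ k : ℝ, 1 < k ∧ k ^ 2 = K :=
    ⟨Real.sqrt K, Real.lt_sqrt_of_sq_lt (by simpa using hK1), Real.sq_sqrt (by linarith)⟩
  have hk0 : 0 < k := by linarith
  have hkr : k * (1 - r) < 1 + r := by
    refine lt_of_pow_lt_pow_left₀ 2 (by linarith [hr.1]) ?_
    rw [mul_pow, hkK]
    exact hKr
  set θ := (1 + k) ^ 2 * (1 - r ^ 2) / (4 * k) with hθ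
  -- Since 4k = (k+1)²-(k-1)², this says k-1 < r(k+1), which is `hkr`.
  have hθ1 : θ < 1 := by
    rw [hθ, div_lt_one (by positivity)]
    have h1 : 0 < r * (k + 1) - (k - 1) := by linarith
    have h2 : 0 < r * (k + 1) + (k - 1) := by nlinarith [hr.1]
    nlinarith [mul_pos h1 h2]
  -- Both conditions hold at c = 0 and persist for small c; the second keeps the radii above 1/2.
  obtain ⟨c, hc0, hc1, hc2⟩ : ∃ c : ℝ, 0 < c ∧ (1 + c) ^ 2 * θ < 1 - k * c ∧ k * c < 1 / 2 := by
    have hcont : Continuous fun c : ℝ => (1 + c) ^ 2 * θ + k * c := by fun_prop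
    have hcont2 : Continuous fun c : ℝ => k * c := by fun_prop
    have e1 : ∀ᶠ c in nhds (0 : ℝ), (1 + c) ^ 2 * θ + k * c < 1 :=
      hcont.continuousAt.eventually_lt_const (by simpa using hθ1)
    have e2 : ∀ᶠ c in nhds (0 : ℝ), k * c < 1 / 2 :=
      hcont2.continuousAt.eventually_lt_const (by norm_num)
    obtain ⟨c, ⟨h1, h2⟩, h3⟩ := (((e1.and e2).filter_mono nhdsWithin_le_nhds).and
      (self_mem_nhdsWithin (s := Ioi (0 : ℝ)))).exists
    exact ⟨c, h3, by linarith, h2⟩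
  obtain ⟨D, hD, hDc⟩ := exists_capMass_le n (1 / c)
  have hM0 : 0 < 1 - 1 / M := by
    rw [sub_pos, div_lt_one (by linarith)]
    exact hM
  refine ⟨c, hc0, D / (1 - 1 / M) * 2 ^ (Module.finrank ℝ (Cn n) - 1), by positivity,
    fun z hz0 hz hzc => ?_⟩
  have hx : 0 < 1 - ‖z‖ := by linarith
  have hxk : (1 - ‖z‖) / k < 1 - ‖z‖ := div_lt_self hx hk
  have hxk0 : 0 < (1 - ‖z‖) / k := by positivity
  have hkx : k * (1 - ‖z‖) ≤ k * c := by gcongr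
  have hxkx : 1 - ‖z‖ < k * (1 - ‖z‖) := by nlinarith
  have h1 := hω.1.weightedMass_mono (capSector_subset_pseudoBall hr hk hc0 hc1 hz0 hz hzc)
    (pseudoBall_subset_unitBall z r)
  have h2 := hω.1.le_weightedMass_capSector (direction z) (c * (1 - ‖z‖))
    (a := 1 - k * (1 - ‖z‖)) (b := 1 - (1 - ‖z‖) / k) (by linarith) (by linarith) (by linarith)
  have h3 := hrev (1 - k * (1 - ‖z‖)) ⟨by linarith, by linarith⟩
  rw [← hkK, sub_sub_cancel, show k * (1 - ‖z‖) / k ^ 2 = (1 - ‖z‖) / k by field_simp] at h3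
  set T := tail ω (1 - (1 - ‖z‖) / k) with hT
  set S := tail ω (1 - k * (1 - ‖z‖)) with hS
  have h4 : (1 - 1 / M) * S ≤ S - T := by
    have : T ≤ 1 / M * S := by
      rw [div_mul_eq_mul_div, one_mul, le_div_iff₀ (by linarith)]
      linarith
    linarith
  have h5 : tail ω ‖z‖ ≤ S := hω.1.tail_le_tail (by linarith) (by linarith) hz.le
  have h6 : tail ω ‖z‖ ≤ (S - T) / (1 - 1 / M) := by
    rw [le_div_iff₀ hM0]
    nlinarith
  have h7 := hDc _ (norm_direction hz0) (1 - ‖z‖) (c * (1 - ‖z‖)) (by positivity)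
    (le_of_eq (by field_simp))
  have h8 := (volume_real_unitBall_pos n).le
  have h9 := capMass_nonneg (direction z) (c * (1 - ‖z‖))
  have h10 := (hω.1.tail_pos (norm_nonneg z) hz).le
  calc blockSize ω z ≤ (volume.real (unitBall n))⁻¹ *
        (D * capMass (direction z) (c * (1 - ‖z‖)) * ((S - T) / (1 - 1 / M))) := by
        rw [blockSize]; gcongr
    _ = D / (1 - 1 / M) * ((volume.real (unitBall n))⁻¹ *
        (capMass (direction z) (c * (1 - ‖z‖)) * (S - T))) := by ring
    _ ≤ D / (1 - 1 / M) * (2 ^ (Module.finrank ℝ (Cn n) - 1) *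
        weightedMass ω (pseudoBall z r)) := by
        refine mul_le_mul_of_nonneg_left (h2.trans ?_) (by positivity)
        gcongr
    _ = _ := by ring

/-- Each Δ(z,r) contains a Euclidean ball of a fixed radius ε around z, and this contains one of
finitely many balls of radius ε/2 with centres from a finite cover. -/
theorem IsRadialWeight.exists_le_pseudoBall [Nontrivial (Cn n)] (hω : IsRadialWeight ω)
    {r s : ℝ} (hr : 0 < r) (hs : s < 1) :
    ∃ c : ℝ, 0 < c ∧ ∀ z : Cn n, ‖z‖ ≤ s → c ≤ weightedMass ω (pseudoBall z r) := by
  set ε := min r 1 * (1 - s) with hε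
  have hs1 : 0 < 1 - s := by linarith
  have hε0 : 0 < ε := by positivity
  have hεs : ε ≤ 1 - s := mul_le_of_le_one_left hs1.le (min_le_right _ _)
  have hball : ∀ z : Cn n, ‖z‖ ≤ s → Metric.ball z ε ⊆ unitBall n := by
    intro z hz w hw
    rw [mem_ball_iff_norm] at hw
    have := norm_le_norm_add_norm_sub' w z
    exact mem_unitBall.mpr (by linarith)
  have hsub : ∀ z : Cn n, ‖z‖ ≤ s → Metric.ball z ε ⊆ pseudoBall z r := by
    intro z hz w hw
    refine ⟨hball z hz hw, ?_⟩
    refine (pseudoDist_le_div (by linarith) (mem_unitBall.mp (hball z hz hw))).trans_lt ?_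
    rw [mem_ball_iff_norm, norm_sub_rev] at hw
    rw [div_lt_iff₀ (by linarith)]
    refine hw.trans_le ?_
    rw [hε]
    gcongr
    exact min_le_left _ _
  have hcpt : IsCompact (Metric.closedBall (0 : Cn n) s) := isCompact_closedBall _ _
  obtain ⟨t, ht, hcov⟩ := hcpt.elim_nhds_subcover (fun z => Metric.ball z (ε / 2))
    fun z _ => Metric.ball_mem_nhds z (by positivity)
  have hpos : ∀ z ∈ t, 0 < weightedMass ω (Metric.ball z (ε / 2)) := fun z hz =>
    hω.weightedMass_ball_pos (by positivity) ((Metric.ball_subset_ball (by linarith)).trans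
      (hball z (by simpa using ht z hz)))
  obtain ⟨c, hc, hct⟩ : ∃ c : ℝ, 0 < c ∧ ∀ z ∈ t, c ≤ weightedMass ω (Metric.ball z (ε / 2)) := by
    rcases t.eq_empty_or_nonempty with rfl | hne
    · exact ⟨1, one_pos, by simp⟩
    · obtain ⟨z₀, hz₀, hmin⟩ := t.exists_min_image
        (fun z => weightedMass ω (Metric.ball z (ε / 2))) hne
      exact ⟨_, hpos z₀ hz₀, hmin⟩
  refine ⟨c, hc, fun z hz => ?_⟩
  obtain ⟨w, hwt, hzw⟩ := mem_iUnion₂.mp (hcov (by simpa using hz : z ∈ _))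
  refine (hct w hwt).trans (hω.weightedMass_mono (subset_trans ?_ (hsub z hz))
    (pseudoBall_subset_unitBall z r))
  refine Metric.ball_subset_ball' ?_
  rw [Metric.mem_ball, dist_comm] at hzw
  linarith

theorem IsDoubling.exists_le_carlesonBlock [Nontrivial (Cn n)] (hω : IsDoubling ω)
    {s : ℝ} (hs : s < 1) :
    ∃ c : ℝ, 0 < c ∧ ∀ z : Cn n, ‖z‖ ≤ s → c ≤ weightedMass ω (carlesonBlock z) := by
  rcases lt_or_ge s 0 with hs0 | hs0
  · exact ⟨1, one_pos, fun z hz => absurd ((norm_nonneg z).trans hz) (not_le.mpr hs0)⟩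
  obtain ⟨C, hC, hCb⟩ := hω.exists_blockSize_le_carlesonBlock (n := n)
  have hs1 : 0 < 1 - s := by linarith
  -- The whole sphere is the cap of size 2, and 1-|z| ≥ 1-s, so this ratio bounds every cap measure
  -- from below.
  obtain ⟨D, hD, hDc⟩ := exists_capMass_le n (2 / (1 - s))
  set σ := (volume : Measure (Cn n)).toSphere.real univ with hσ
  have hσ0 : 0 < σ := by
    rw [hσ, Measure.toSphere_real_apply_univ]
    exact mul_pos (Nat.cast_pos.mpr Module.finrank_pos) (volume_real_unitBall_pos n)
  have hv := volume_real_unitBall_pos n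
  have hts := hω.1.tail_pos hs0 hs
  have hW : 0 < weightedMass ω (unitBall n) := hω.1.weightedMass_ball_pos one_pos subset_rfl
  refine ⟨min (weightedMass ω (unitBall n))
    (C⁻¹ * ((volume.real (unitBall n))⁻¹ * (D⁻¹ * σ * tail ω s))), by positivity, fun z hz => ?_⟩
  rcases eq_or_ne z 0 with rfl | hz0
  · rw [carlesonBlock_zero]
    exact min_le_left _ _
  · refine (min_le_right _ _).trans ?_
    rw [inv_mul_le_iff₀ hC]
    refine le_trans ?_ (hCb z hz0 (by linarith))
    rw [blockSize]
    have h1 : D⁻¹ * σ ≤ capMass (direction z) (1 - ‖z‖) := by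
      rw [inv_mul_le_iff₀ hD, hσ, ← capMass_two_eq (norm_direction hz0)]
      refine hDc _ (norm_direction hz0) _ _ (by linarith) ?_
      rw [div_mul_eq_mul_div, le_div_iff₀ hs1]
      linarith
    have h2 := hω.1.tail_le_tail (norm_nonneg z) hz hs.le
    have h3 := capMass_nonneg (direction z) (1 - ‖z‖)
    gcongr

end WeightedMass

/-! ### Calculus of comparability -/

section Comparable

theorem ComparableWith.symm {C A B : ℝ} (h : ComparableWith C A B) : ComparableWith C B A :=
  ⟨h.2, h.1⟩

theorem ComparableWith.trans {C D A B X : ℝ} (hC : 0 ≤ C) (hD : 0 ≤ D)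
    (h : ComparableWith C A B) (h' : ComparableWith D B X) : ComparableWith (C * D) A X := by
  constructor
  · calc A ≤ C * B := h.1
      _ ≤ C * (D * X) := mul_le_mul_of_nonneg_left h'.1 hC
      _ = C * D * X := by ring
  · calc X ≤ D * B := h'.2
      _ ≤ D * (C * A) := mul_le_mul_of_nonneg_left h.2 hD
      _ = C * D * A := by ring

theorem ComparableWith.mono {C D A B : ℝ} (hA : 0 ≤ A) (hB : 0 ≤ B) (hCD : C ≤ D)
    (h : ComparableWith C A B) : ComparableWith D A B :=
  ⟨h.1.trans (mul_le_mul_of_nonneg_right hCD hB), h.2.trans (mul_le_mul_of_nonneg_right hCD hA)⟩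

theorem ComparableWith.of_bounds {c W A B : ℝ} (hc : 0 < c) (hA : c ≤ A) (hA' : A ≤ W)
    (hB : c ≤ B) (hB' : B ≤ W) : ComparableWith (W / c) A B := by
  have hW : 0 ≤ W := (hc.le.trans hA).trans hA'
  constructor <;> rw [div_mul_eq_mul_div, le_div_iff₀ hc] <;> nlinarith

end Comparable

/-! ### Assembling the comparisons -/

section BlocksComparable

variable {n : ℕ} {ω : ℝ → ℝ} {r : ℝ}

theorem IsDoubling.exists_pseudoBall_comparable_carlesonBlock [Nontrivial (Cn n)]
    (hω : IsDoubling ω) {K : ℝ} (hr : r ∈ Ioo (0 : ℝ) 1) (hK : K ∈ reverseDoublingConstants ω)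
    (hKr : K * (1 - r) ^ 2 < (1 + r) ^ 2) :
    ∃ C : ℝ, 0 < C ∧ ∀ z ∈ unitBall n,
      ComparableWith C (weightedMass ω (pseudoBall z r)) (weightedMass ω (carlesonBlock z)) := by
  obtain ⟨c₁, hc₁, C₁, hC₁, h₁⟩ := hω.exists_pseudoBall_le_blockSize (n := n) hr
  obtain ⟨c₂, hc₂, C₂, hC₂, h₂⟩ := hω.exists_blockSize_le_pseudoBall (n := n) hr hK hKr
  obtain ⟨C₃, hC₃, h₃⟩ := hω.exists_blockSize_le_carlesonBlock (n := n)
  -- The cap at 1/2 excludes z = 0 from the boundary region.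
  set c := min (min c₁ c₂) (1 / 2) with hc
  have hc0 : 0 < c := by positivity
  obtain ⟨m₁, hm₁, hb₁⟩ := hω.1.exists_le_pseudoBall (n := n) hr.1 (s := 1 - c) (by linarith)
  obtain ⟨m₂, hm₂, hb₂⟩ := hω.exists_le_carlesonBlock (n := n) (s := 1 - c) (by linarith)
  set W := weightedMass ω (unitBall n)
  have hW : 0 < W := hω.1.weightedMass_ball_pos one_pos subset_rfl
  have hm : 0 < min m₁ m₂ := lt_min hm₁ hm₂
  refine ⟨C₁ * C₃ + C₂ + W / min m₁ m₂, by positivity, fun z hz => ?_⟩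
  have hP := hω.1.weightedMass_nonneg (pseudoBall_subset_unitBall z r)
  have hS := hω.1.weightedMass_nonneg (carlesonBlock_subset_unitBall z)
  have hWm : 0 < W / min m₁ m₂ := by positivity
  have hC₁₃ : 0 < C₁ * C₃ := by positivity
  have hz1 := mem_unitBall.mp hz
  rcases le_or_gt ‖z‖ (1 - c) with hzc | hzc
  · refine ComparableWith.mono hP hS (by linarith : W / min m₁ m₂ ≤ _) ?_
    exact .of_bounds hm ((min_le_left _ _).trans (hb₁ z hzc))
      (hω.1.weightedMass_mono (pseudoBall_subset_unitBall z r) subset_rfl)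
      ((min_le_right _ _).trans (hb₂ z hzc))
      (hω.1.weightedMass_mono (carlesonBlock_subset_unitBall z) subset_rfl)
  · have hz0 : z ≠ 0 := by
      rintro rfl
      rw [norm_zero] at hzc
      linarith [min_le_right (min c₁ c₂) (1 / 2)]
    have hzc₁ : 1 - ‖z‖ ≤ c₁ := by
      linarith [(min_le_left (min c₁ c₂) (1 / 2)).trans (min_le_left _ _)]
    have hzc₂ : 1 - ‖z‖ ≤ c₂ := by
      linarith [(min_le_left (min c₁ c₂) (1 / 2)).trans (min_le_right _ _)]
    constructor
    · calc _ ≤ C₁ * blockSize ω z := h₁ z hz0 hz1 hzc₁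
        _ ≤ C₁ * (C₃ * weightedMass ω (carlesonBlock z)) := by
          gcongr
          exact h₃ z hz0 hz1
        _ = C₁ * C₃ * weightedMass ω (carlesonBlock z) := by ring
        _ ≤ _ := by
          gcongr
          linarith
    · calc _ ≤ blockSize ω z := hω.1.weightedMass_carlesonBlock_le hz0 hz1
        _ ≤ C₂ * weightedMass ω (pseudoBall z r) := h₂ z hz0 hz1 hzc₂
        _ ≤ _ := by
          gcongr
          linarith

theorem IsDoubling.exists_carlesonBlock_comparable [Nontrivial (Cn n)]
    (hω : IsDoubling ω) (hr : r ∈ Ioo (0 : ℝ) 1) :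
    ∃ C : ℝ, 0 < C ∧ ∀ z ∈ unitBall n, ∀ w ∈ pseudoBall z r,
      ComparableWith C (weightedMass ω (carlesonBlock z)) (weightedMass ω (carlesonBlock w)) := by
  have hr2 : 0 < 1 - r ^ 2 := by nlinarith [hr.1, hr.2]
  set A := 4 / (1 - r ^ 2) with hA
  set B := 8 / (1 - r ^ 2) + 1 with hB
  have hA1 : 1 ≤ A := by
    rw [hA, le_div_iff₀ hr2]
    nlinarith [hr.1]
  -- The bound on the directions is in terms of 1-|z|; passing to 1-|w| costs the factor A.
  obtain ⟨C₁, hC₁, h₁⟩ := hω.exists_blockSize_le_blockSize (n := n) A (B * A)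
  obtain ⟨C₂, hC₂, h₂⟩ := hω.exists_blockSize_le_blockSize (n := n) A B
  obtain ⟨C₃, hC₃, h₃⟩ := hω.exists_blockSize_le_carlesonBlock (n := n)
  obtain ⟨m, hm, hb⟩ := hω.exists_le_carlesonBlock (n := n) (s := 1 - 1 / A)
    (by linarith [show 0 < 1 / A by positivity])
  set W := weightedMass ω (unitBall n)
  have hW : 0 < W := hω.1.weightedMass_ball_pos one_pos subset_rfl
  refine ⟨C₁ * C₃ + C₂ * C₃ + W / m, by positivity, fun z hz w hw => ?_⟩
  have hSz := hω.1.weightedMass_nonneg (carlesonBlock_subset_unitBall z)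
  have hSw := hω.1.weightedMass_nonneg (carlesonBlock_subset_unitBall w)
  have hWm : 0 < W / m := by positivity
  have hC₁₃ : 0 < C₁ * C₃ := by positivity
  have hC₂₃ : 0 < C₂ * C₃ := by positivity
  have hz1 := mem_unitBall.mp hz
  have hw1 := mem_unitBall.mp hw.1
  obtain ⟨hwz, hzw, -⟩ := le_of_mem_pseudoBall hr hz hw
  rw [← hA] at hwz hzw
  -- Only the origin is exceptional. If one point is 0, both lie in the compact ball of radius
  -- 1-1/A.
  by_cases h0 : z = 0 ∨ w = 0
  · have hle : ∀ x : ℝ, 1 ≤ A * (1 - x) → x ≤ 1 - 1 / A := by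
      intro x hx
      have : 1 / A ≤ 1 - x := by
        rw [div_le_iff₀ (by linarith)]
        linarith
      linarith
    have hzs : ‖z‖ ≤ 1 - 1 / A ∧ ‖w‖ ≤ 1 - 1 / A := by
      rcases h0 with rfl | rfl
      · rw [norm_zero] at hzw ⊢
        exact ⟨hle 0 (by linarith), hle _ (by linarith)⟩
      · rw [norm_zero] at hwz ⊢
        exact ⟨hle _ (by linarith), hle 0 (by linarith)⟩
    refine ComparableWith.mono hSz hSw (by linarith : W / m ≤ _) ?_
    exact .of_bounds hm (hb z hzs.1)
      (hω.1.weightedMass_mono (carlesonBlock_subset_unitBall z) subset_rfl) (hb w hzs.2)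
      (hω.1.weightedMass_mono (carlesonBlock_subset_unitBall w) subset_rfl)
  · obtain ⟨hz0, hw0⟩ := not_or.mp h0
    have hd := norm_one_sub_inner_direction_le_of_mem_pseudoBall hr hz hw hz0 hw0
    rw [← hB] at hd
    constructor
    · calc _ ≤ blockSize ω z := hω.1.weightedMass_carlesonBlock_le hz0 hz1
        _ ≤ C₁ * blockSize ω w := by
          refine h₁ z w hz0 hw0 hz1 hw1 hzw ?_
          rw [norm_one_sub_inner_comm, mul_assoc]
          refine hd.trans ?_
          gcongr
        _ ≤ C₁ * (C₃ * weightedMass ω (carlesonBlock w)) := by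
          gcongr
          exact h₃ w hw0 hw1
        _ = C₁ * C₃ * weightedMass ω (carlesonBlock w) := by ring
        _ ≤ _ := by
          gcongr
          linarith
    · calc _ ≤ blockSize ω w := hω.1.weightedMass_carlesonBlock_le hw0 hw1
        _ ≤ C₂ * blockSize ω z := h₂ w z hw0 hz0 hw1 hz1 hwz hd
        _ ≤ C₂ * (C₃ * weightedMass ω (carlesonBlock z)) := by
          gcongr
          exact h₃ z hz0 hz1
        _ = C₂ * C₃ * weightedMass ω (carlesonBlock z) := by ring
        _ ≤ _ := by
          gcongr
          linarith

theorem IsDoubling.blocksComparable [Nontrivial (Cn n)] (hω : IsDoubling ω) {K : ℝ}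
    (hr : r ∈ Ioo (0 : ℝ) 1) (hK : K ∈ reverseDoublingConstants ω)
    (hKr : K * (1 - r) ^ 2 < (1 + r) ^ 2) : BlocksComparable n ω r := by
  obtain ⟨C, hC, h⟩ := hω.exists_pseudoBall_comparable_carlesonBlock (n := n) hr hK hKr
  obtain ⟨D, hD, h'⟩ := hω.exists_carlesonBlock_comparable (n := n) hr
  have h1 : 0 < C * D := by positivity
  have h2 : 0 < C * (D * C) := by positivity
  refine ⟨C * (D * C) + C * D + D, by positivity, fun z hz w hw => ?_⟩
  have hPz := hω.1.weightedMass_nonneg (pseudoBall_subset_unitBall z r)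
  have hPw := hω.1.weightedMass_nonneg (pseudoBall_subset_unitBall w r)
  have hSz := hω.1.weightedMass_nonneg (carlesonBlock_subset_unitBall z)
  have hSw := hω.1.weightedMass_nonneg (carlesonBlock_subset_unitBall w)
  refine ⟨?_, ?_, ?_⟩
  -- The chain is Δ(z,r), S_z, S_w, Δ(w,r).
  · exact ((h z hz).trans hC.le (by positivity)
      ((h' z hz w hw).trans hD.le hC.le (h w hw.1).symm)).mono hPz hPw (by linarith)
  · exact ((h w hw.1).trans hC.le hD.le (h' z hz w hw).symm).mono hPw hSz (by linarith)
  · exact (h' z hz w hw).mono hSz hSw (by linarith)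

/-- The hypothesis rearranges to K_ω < (1+r²)/(1-r)², so some admissible K satisfies K(1-r)² < 1+r²
< (1+r)². -/
theorem IsTwoSidedDoubling.blocksComparable [Nontrivial (Cn n)] (hω : IsTwoSidedDoubling ω)
    (hr : r ∈ Ioo (0 : ℝ) 1) (h : 1 < 1 / infReverseDoubling ω + 2 * r / (1 + r ^ 2)) :
    BlocksComparable n ω r := by
  have hne := hω.2.2
  have hinf : 1 ≤ infReverseDoubling ω := le_csInf hne fun K hK => hK.1.le
  have hlt : infReverseDoubling ω < (1 + r ^ 2) / (1 - r) ^ 2 := by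
    have h1r : 0 < 1 - r := by linarith [hr.2]
    have h1 : (1 - r) ^ 2 / (1 + r ^ 2) = 1 - 2 * r / (1 + r ^ 2) := by
      field_simp
      ring
    have h2 : (1 - r) ^ 2 / (1 + r ^ 2) < 1 / infReverseDoubling ω := by linarith
    rw [div_lt_div_iff₀ (by positivity) (by linarith)] at h2
    rw [lt_div_iff₀ (by positivity)]
    linarith
  obtain ⟨K, hK, hKlt⟩ := exists_lt_of_csInf_lt hne hlt
  have h1r : 0 < 1 - r := by linarith [hr.2]
  rw [lt_div_iff₀ (by positivity)] at hKlt
  exact hω.1.blocksComparable hr hK (by nlinarith [hr.1])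

end BlocksComparable

end BallWeights

end

theorem mainTheorem8 (n : ℕ) (hn : 1 ≤ n) (ω : ℝ → ℝ) :
    (∀ r ∈ Set.Ioo (0 : ℝ) 1, BallWeights.IsTwoSidedDoubling ω →
      1 < 1 / BallWeights.infReverseDoubling ω + 2 * r / (1 + r ^ 2) →
      BallWeights.BlocksComparable n ω r) ∧
    (BallWeights.IsRegularWeight ω →
      ∀ r ∈ Set.Ioo (0 : ℝ) 1, BallWeights.BlocksComparable n ω r) := by
  have : Nonempty (Fin n) := ⟨⟨0, hn⟩⟩
  have : Nontrivial (BallWeights.Cn n) := inferInstance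
  refine ⟨fun r hr hω h => hω.blocksComparable hr h, fun hω r hr => ?_⟩
  refine hω.isTwoSidedDoubling.blocksComparable hr ?_
  -- With K_ω = 1 the condition becomes 2r/(1+r²) > 0.
  rw [hω.infReverseDoubling_eq, div_one, lt_add_iff_pos_right]
  have := hr.1
  positivity
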